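/- **Setting.** Let $X$ be a real Banach space (a complex Banach space may be regarded as a real one), let $L$ be the generator of a strongly continuous semigroup $e^{tL}$, $t\ge 0$, on $X$, let $N:X\to X$, and put $F(v)=Lv+N(v)$. Let $p\ge 1$ be an integer and let $u:[t_0,T]\to X$, $t_0<T$, be a solution of $u'(t)=F(u(t))$ with $u(t)\in D(L)$ for all $t\in[t_0,T]$. Assume that $u$ is $p$ times continuously differentiable on $[t_0,T]$ and that, for some $\delta>0$, $N$ is $p$ times continuously Fréchet differentiable in the strip $\{x:\operatorname{dist}(x,u([t_0,T]))<\delta\}$, with derivatives of orders $1,\dots,p$ bounded uniformly there. For $\tau\ge0$ let $\varphi_0(\tau L)=e^{\tau L}$ and $\varphi_k(\tau L)=\int_0^1 e^{(1-\theta)\tau L}\frac{\theta^{k-1}}{(k-1)!}\,d\theta$ for $k\ge1$. **Method.** An $s$-stage IMEXP Runge–Kutta method is given by nodes $c_i\ge0$, real rational functions $R_{1i}$ ($2\le i\le s$) and $R_1$, and functions $a_{ij}(z)$ ($2\le j<i\le s$), $b_i(z)$ ($2\le i\le s$) that are finite real linear combinations of functions $\varphi_k(\gamma z)$, $k\ge0$,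 $\gamma\ge0$. One step of size $h>0$ starting at $v$ is $$U_i=v+c_ihR_{1i}(c_ihL)F(v)+h\sum_{j=2}^{i-1}a_{ij}(hL)\bigl(N(U_j)-N(v)\bigr),\quad 2\le i\le s,$$ $$\Phi_h(v)=v+hR_1(hL)F(v)+h\sum_{i=2}^{s}b_i(hL)\bigl(N(U_i)-N(v)\bigr).$$ For a rational function $R=P/Q$ in lowest terms and $\tau\ge 0$, $R(\tau L)=P(\tau L)Q(\tau L)^{-1}$, where $Q(\tau L)$ is required to be a bijection from $D((\tau L)^{\deg Q})$ onto $X$ (and $0\cdot L$ is the zero operator on $X$). Assume that, for all sufficiently small $h>0$, the operators $R_1(hL)$ and $R_{1i}(c_ihL)$ exist in this sense, and that $F(u(t_n))$ lies in their domains (this is automatic if $\deg P\le\deg Q$) for every $t_n=t_0+nh$, $n\ge0$, with $t_n+h\le T$. **Stiff order conditions.** Write $Z=hL$ and, for $k\ge2$, $$\psi_{k,i}(Z)=\sum_{j=2}^{i-1}a_{ij}(Z)\frac{c_j^{k-1}}{(k-1)!}-c_i^k\varphi_k(c_iZ),\qquad \psi_k(Z)=\sum_{i=2}^{s}b_i(Z)\frac{c_i^{k-1}}{(k-1)!}-\varphi_k(Z).$$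 Consider the trees formed from leaves $[k]$, $k\ge2$, and nodes $[\ell;\tau_1,\dots,\tau_m]$, $\ell\ge0$, $m\ge1$, with order $|[k]|=k$ and $|[\ell;\tau_1,\dots,\tau_m]|=1+\ell+|\tau_1|+\dots+|\tau_m|$. For vectors $w_k\in X$ and bounded $m$-linear maps $G_{\ell,m}:X^m\to X$ set $$\Psi_i([k])=\psi_{k,i}(Z)w_k,\qquad \Psi_i([\ell;\tau_1,\dots,\tau_m])=\sum_{j=2}^{i-1}a_{ij}(Z)\,c_j^{\ell}\,G_{\ell,m}\bigl(\Psi_j(\tau_1),\dots,\Psi_j(\tau_m)\bigr),$$ $$\Psi([k])=\psi_k(Z)w_k,\qquad \Psi([\ell;\tau_1,\dots,\tau_m])=\sum_{i=2}^{s}b_i(Z)\,c_i^{\ell}\,G_{\ell,m}\bigl(\Psi_i(\tau_1),\dots,\Psi_i(\tau_m)\bigr).$$ The coefficients $a_{ij}(hL),b_i(hL)$ satisfy the stiff order conditions of exponential Runge–Kutta methods up to order $p$ if $\Psi(\tau)=0$ for all trees $\tau$ with $|\tau|\le p$ and for all vectors $w_k$ and all bounded multilinear maps $G_{\ell,m}$.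 **Theorem.** Suppose that, for all sufficiently small $h>0$, the coefficients $a_{ij}(hL)$, $b_i(hL)$ satisfy the stiff order conditions up to order $p$, and that $$\bigl(R_{1i}(c_ihL)-\varphi_1(c_ihL)\bigr)F(u(t_n))=\mathcal O(h^{p-1})\quad(2\le i\le s),\qquad \bigl(R_1(hL)-\varphi_1(hL)\bigr)F(u(t_n))=\mathcal O(h^{p}).$$ Then the method has order of consistency $p+1$, that is, its local error satisfies $$\Phi_h(u(t_n))-u(t_n+h)=\mathcal O(h^{p+1}).$$ Here $\mathcal O(h^q)$ means: there is a constant $C$, independent of $h$ and $n$, such that for all sufficiently small $h>0$ and all $n\ge0$ with $t_n+h\le T$, where $t_n=t_0+nh$, the norm of the expression is at most $Ch^q$. -/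

import Mathlib

open Filter Topology
open scoped NNReal

noncomputable section

namespace IMEXP

variable {X : Type*} [NormedAddCommGroup X] [NormedSpace ℝ X]

/-! ### Strongly continuous semigroups and their generators -/

/-- `S t`, `t ≥ 0`, is a strongly continuous semigroup of bounded operators (values of `S` at
negative times are irrelevant and never used). -/
structure IsC0Semigroup (S : ℝ → X →L[ℝ] X) : Prop where
  map_zero : S 0 = ContinuousLinearMap.id ℝ X
  map_add : ∀ s t : ℝ, 0 ≤ s → 0 ≤ t → S (s + t) = (S s).comp (S t)
  continuousOn : ∀ x : X, ContinuousOn (fun t => S t x) (Set.Ici 0)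

/-- The (in general unbounded) operator `L` is the infinitesimal generator of `S`: its domain
consists of exactly those `x` for which `(S t x - x) / t` converges as `t → 0+`, and `L x` is the
limit. -/
structure IsGenerator (S : ℝ → X →L[ℝ] X) (L : X →ₗ.[ℝ] X) : Prop where
  mem_domain_iff : ∀ x : X, x ∈ L.domain ↔
    ∃ y : X, Tendsto (fun t : ℝ => t⁻¹ • (S t x - x)) (𝓝[>] 0) (𝓝 y)
  tendsto : ∀ x : L.domain,
    Tendsto (fun t : ℝ => t⁻¹ • (S t (x : X) - (x : X))) (𝓝[>] 0) (𝓝 (L x))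

/-! ### The `φ`-functions and their linear combinations -/

/-- `φ_k(t L) x`, where `S t = exp (t L)`: `φ_0(t L) x = exp (t L) x` and, for `k ≥ 1`,
`φ_k(t L) x = ∫_0^1 θ^(k-1)/(k-1)! exp ((1-θ) t L) x dθ`. -/
def phi (S : ℝ → X →L[ℝ] X) : ℕ → ℝ → X → X
  | 0, t, x => S t x
  | k + 1, t, x => ∫ θ in (0 : ℝ)..1, (θ ^ k / (k.factorial : ℝ)) • S ((1 - θ) * t) x

/-- A linear combination `f(z) = ∑ r_{k,γ} φ_k(γ z)` of `φ`-functions with scaled arguments. -/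
abbrev PhiComb : Type := (ℕ × ℝ≥0) →₀ ℝ

/-- `f(h L) x` for a linear combination `f` of `φ`-functions. -/
def PhiComb.apply (f : PhiComb) (S : ℝ → X →L[ℝ] X) (h : ℝ) (x : X) : X :=
  f.sum fun kγ r => r • phi S kγ.1 ((kγ.2 : ℝ) * h) x

/-! ### Rational functions of an unbounded operator -/

open Classical in
/-- The value `A x`, extended by `0` outside the domain of `A`. -/
def opApply (A : X →ₗ.[ℝ] X) (x : X) : X :=
  if hx : x ∈ A.domain then A ⟨x, hx⟩ else 0

open Classical in
/-- The operator `τ L`; for `τ = 0` this is the zero operator, defined on all of `X`. -/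
def scaleOp (τ : ℝ) (L : X →ₗ.[ℝ] X) : X →ₗ.[ℝ] X :=
  if τ = 0 then ⟨⊤, 0⟩ else τ • L

/-- `x` belongs to the domain of `A ^ n`. -/
def InPowDomain (A : X →ₗ.[ℝ] X) (n : ℕ) (x : X) : Prop :=
  ∀ j < n, (opApply A)^[j] x ∈ A.domain

/-- `q(A) x` for a polynomial `q` (meaningful for `x` in the domain of `A ^ q.natDegree`). -/
def polyApply (A : X →ₗ.[ℝ] X) (q : Polynomial ℝ) (x : X) : X :=
  q.sum fun j r => r • (opApply A)^[j] x

/-- The rational function `R = num / denom` may be evaluated at `A`: the operator `denom(A)` is a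
bijection of the domain of `A ^ deg denom` onto `X`. -/
def RatDefined (A : X →ₗ.[ℝ] X) (R : RatFunc ℝ) : Prop :=
  ∀ v : X, ∃! y : X, InPowDomain A R.denom.natDegree y ∧ polyApply A R.denom y = v

/-- `v` is in the domain of `R(A) = num(A) denom(A)⁻¹`; this is automatic if `RatDefined A R` and
`deg num ≤ deg denom`. -/
def InRatDomain (A : X →ₗ.[ℝ] X) (R : RatFunc ℝ) (v : X) : Prop :=
  ∃ y : X, InPowDomain A (max R.denom.natDegree R.num.natDegree) y ∧ polyApply A R.denom y = v

open Classical in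
/-- `R(A) v = num(A) denom(A)⁻¹ v` (and `0` if `v` is not in the domain). -/
def ratApply (A : X →ₗ.[ℝ] X) (R : RatFunc ℝ) (v : X) : X :=
  if hv : InRatDomain A R v then polyApply A R.num hv.choose else 0

/-! ### The initial value problem -/

/-- The right-hand side `F(v) = L v + N(v)`. -/
def rhs (L : X →ₗ.[ℝ] X) (N : X → X) (v : X) : X := opApply L v + N v

/-- `u` is a classical solution of `u' = L u + N(u)` on `[t₀, T]`. -/
def IsSolution (L : X →ₗ.[ℝ] X) (N : X → X) (u : ℝ → X) (t₀ T : ℝ) : Prop :=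
  ∀ t ∈ Set.Icc t₀ T, u t ∈ L.domain ∧ HasDerivWithinAt u (rhs L N (u t)) (Set.Icc t₀ T) t

/-- Smoothness of order `q`: the solution `u` is `q` times continuously differentiable on
`[t₀, T]` (so its derivatives are bounded there), and `N` is `q` times continuously Fréchet
differentiable, with uniformly bounded derivatives, in a strip along the solution. -/
structure IsRegular (N : X → X) (u : ℝ → X) (t₀ T : ℝ) (q : ℕ) : Prop where
  solution : ContDiffOn ℝ (q : WithTop ℕ∞) u (Set.Icc t₀ T)
  nonlinearity : ∃ δ > 0,
    ContDiffOn ℝ (q : WithTop ℕ∞) N (Metric.thickening δ (u '' Set.Icc t₀ T)) ∧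
    ∃ C : ℝ, ∀ x ∈ Metric.thickening δ (u '' Set.Icc t₀ T), ∀ m : ℕ, 1 ≤ m → m ≤ q →
      ‖iteratedFDeriv ℝ m N x‖ ≤ C

/-! ### The methods -/

/-- The data of an implicit-explicit exponential Runge-Kutta method with `s` stages: nodes `c i`
(`2 ≤ i ≤ s`), coefficient functions `a i j` (`2 ≤ j < i ≤ s`) and `b i` (`2 ≤ i ≤ s`), and the
rational functions `Rstage i` (`2 ≤ i ≤ s`) and `Rfinal`. Entries with other indices are not
used. -/
structure Method where
  s : ℕ
  c : ℕ → ℝ≥0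
  a : ℕ → ℕ → PhiComb
  b : ℕ → PhiComb
  Rstage : ℕ → RatFunc ℝ
  Rfinal : RatFunc ℝ

namespace Method

/-- The internal stage `U_i` of one step of size `h` from the value `v`:
`U_i = v + c_i h R_{1i}(c_i h L) F(v) + h ∑_{j=2}^{i-1} a_{ij}(h L) (N(U_j) - N(v))`. -/
def stage (M : Method) (L : X →ₗ.[ℝ] X) (S : ℝ → X →L[ℝ] X) (N : X → X) (h : ℝ) (v : X)
    (i : ℕ) : X :=
  v + ((M.c i : ℝ) * h) • ratApply (scaleOp ((M.c i : ℝ) * h) L) (M.Rstage i) (rhs L N v)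
    + h • ∑ j : Finset.Ico 2 i, (M.a i j).apply S h (N (stage M L S N h v j) - N v)
termination_by i
decreasing_by exact (Finset.mem_Ico.mp j.2).2

/-- One step of size `h` from the value `v`:
`v + h R_1(h L) F(v) + h ∑_{i=2}^{s} b_i(h L) (N(U_i) - N(v))`. -/
def step (M : Method) (L : X →ₗ.[ℝ] X) (S : ℝ → X →L[ℝ] X) (N : X → X) (h : ℝ) (v : X) : X :=
  v + h • ratApply (scaleOp h L) M.Rfinal (rhs L N v)
    + h • ∑ i ∈ Finset.Icc 2 M.s, (M.b i).apply S h (N (M.stage L S N h v i) - N v)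

end Method

/-! ### Stiff order conditions of exponential Runge-Kutta methods -/

/-- The trees that index the stiff order conditions. `leaf k` stands for the defect of order
`k + 2`; `node l m t` stands for a node carrying the weight `c ^ l` and an `(m + 1)`-linear map
applied to the subtrees `t 0, …, t m`. -/
inductive StiffTree : Type
  | leaf (k : ℕ) : StiffTree
  | node (l m : ℕ) (t : Fin (m + 1) → StiffTree) : StiffTree

/-- The order of a tree, i.e. the power of `h` that multiplies the corresponding term. -/
def StiffTree.order : StiffTree → ℕ
  | .leaf k => k + 2
  | .node l _ t => 1 + l + ∑ r, (t r).order

namespace Method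

/-- `ψ_{k,i}(h L) x = ∑_{j=2}^{i-1} c_j^(k-1)/(k-1)! a_{ij}(h L) x - c_i^k φ_k(c_i h L) x`. -/
def psiStage (M : Method) (S : ℝ → X →L[ℝ] X) (h : ℝ) (k i : ℕ) (x : X) : X :=
  ∑ j ∈ Finset.Ico 2 i, ((M.c j : ℝ) ^ (k - 1) / ((k - 1).factorial : ℝ)) • (M.a i j).apply S h x
    - (M.c i : ℝ) ^ k • phi S k ((M.c i : ℝ) * h) x

/-- `ψ_k(h L) x = ∑_{i=2}^{s} c_i^(k-1)/(k-1)! b_i(h L) x - φ_k(h L) x`. -/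
def psiFinal (M : Method) (S : ℝ → X →L[ℝ] X) (h : ℝ) (k : ℕ) (x : X) : X :=
  ∑ i ∈ Finset.Icc 2 M.s, ((M.c i : ℝ) ^ (k - 1) / ((k - 1).factorial : ℝ)) • (M.b i).apply S h x
    - phi S k h x

/-- The contribution of a tree to the `i`-th stage, for given vectors `w k` and given
multilinear maps `G l m`. -/
def stageTerm (M : Method) (S : ℝ → X →L[ℝ] X) (h : ℝ) (w : ℕ → X)
    (G : ℕ → (m : ℕ) → X [×m]→L[ℝ] X) : StiffTree → ℕ → X
  | .leaf k, i => M.psiStage S h (k + 2) i (w k)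
  | .node l m t, i => ∑ j ∈ Finset.Ico 2 i, (M.a i j).apply S h
      ((M.c j : ℝ) ^ l • G l (m + 1) fun r => stageTerm M S h w G (t r) j)

/-- The contribution of a tree to the result of the step. -/
def finalTerm (M : Method) (S : ℝ → X →L[ℝ] X) (h : ℝ) (w : ℕ → X)
    (G : ℕ → (m : ℕ) → X [×m]→L[ℝ] X) : StiffTree → X
  | .leaf k => M.psiFinal S h (k + 2) (w k)
  | .node l m t => ∑ i ∈ Finset.Icc 2 M.s, (M.b i).apply S h
      ((M.c i : ℝ) ^ l • G l (m + 1) fun r => M.stageTerm S h w G (t r) i)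

/-- The coefficients `a_{ij}(h L)`, `b_i(h L)` satisfy the stiff order conditions of exponential
Runge-Kutta methods up to order `p`: for all vectors and all bounded multilinear maps, the terms of
all trees of order at most `p` vanish. With `Z = h L`, `J = G 0 1`, `K = G 1 1` and `B = G 0 2`,
these are
* order 2: `∑ b_i(Z) c_i = φ_2(Z)`;
* order 3: `∑ b_i(Z) c_i^2 / 2! = φ_3(Z)`, `∑ b_i(Z) J ψ_{2,i}(Z) = 0`;
* order 4: `∑ b_i(Z) c_i^3 / 3! = φ_4(Z)`, `∑ b_i(Z) J ψ_{3,i}(Z) = 0`,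
  `∑ b_i(Z) J ∑ a_{ij}(Z) J ψ_{2,j}(Z) = 0`, `∑ b_i(Z) c_i K ψ_{2,i}(Z) = 0`;
* order 5: nine conditions, among them `∑ b_i(Z) B(ψ_{2,i}(Z), ψ_{2,i}(Z)) = 0`;
and so on. (The conditions `∑ b_i = φ_1` and `∑_j a_{ij}(Z) = c_i φ_1(c_i Z)` on the sums that
include the first stage are built into the form of the scheme.) -/
def StiffOrder (M : Method) (S : ℝ → X →L[ℝ] X) (h : ℝ) (p : ℕ) : Prop :=
  ∀ (w : ℕ → X) (G : ℕ → (m : ℕ) → X [×m]→L[ℝ] X) (τ : StiffTree),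
    τ.order ≤ p → M.finalTerm S h w G τ = 0

/-- The operators `R_1(h L)` and `R_{1i}(c_i h L)` of the method exist. -/
def OperatorsDefined (M : Method) (L : X →ₗ.[ℝ] X) (h : ℝ) : Prop :=
  RatDefined (scaleOp h L) M.Rfinal ∧
    ∀ i ∈ Finset.Icc 2 M.s, RatDefined (scaleOp ((M.c i : ℝ) * h) L) (M.Rstage i)

/-- The vector `v` is in the domains of `R_1(h L)` and `R_{1i}(c_i h L)`. -/
def InOperatorDomains (M : Method) (L : X →ₗ.[ℝ] X) (h : ℝ) (v : X) : Prop :=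
  InRatDomain (scaleOp h L) M.Rfinal v ∧
    ∀ i ∈ Finset.Icc 2 M.s, InRatDomain (scaleOp ((M.c i : ℝ) * h) L) (M.Rstage i) v

end Method

/-- `g h t_n = O(h^q)` as `h → 0+`, with a constant independent of `h` and `n`, for the grid points
`t_n = t₀ + n h` with `t_n + h ≤ T`. -/
def IsUniformO (t₀ T : ℝ) (q : ℕ) (g : ℝ → ℝ → X) : Prop :=
  ∃ C : ℝ, ∀ᶠ h in 𝓝[>] (0 : ℝ), ∀ n : ℕ, t₀ + n * h + h ≤ T → ‖g h (t₀ + n * h)‖ ≤ C * h ^ q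

end IMEXP

end

/-!
Fix a step size `h` and a grid point `t`, and put `v = u t`. The local error is compared with a
*predictor*, the solution through `v` of the equation in which the nonlinearity along `u` is replaced
by its Taylor polynomial at `t`; by the variation-of-constants formula this is a combination of
`φ`-functions of `τ L` applied to derivatives of `N ∘ u` (`predictor`). After a full step it agrees
with `u (t + h)` up to `O(h^(p+1))` (`isBigO_predictor_sub_solution`).

At an internal stage the predictor is evaluated at `τ = c_i h`, and `t + c_i h` may exceed `T`, as the
nodes are not restricted to `[0, 1]`. Two facts deal with this. First, `u` extends to a `C^p` curve on
the line (`exists_contDiff_eqOn_Icc`). Secondly, the predictor is a Taylor polynomial of `u` plus an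
explicit term `τ^p φ_p(τ L) u^(p)(t)` (`predictor_eq`), hence close to the extended curve whether or
not this curve still solves the equation. The identity rests on `L u^(k) = u^(k+1) - (N ∘ u)^(k)`,
which is used in integrated form: then it is a relation between bounded operators and follows by
differentiating in `t` (`apply_sub_eq_integral_of_hasDerivWithinAt`).

The stage errors `e_i`, the differences of the stages and their predictors, are `O(h)`. Expanding `N`
in powers of `e_i`, and its derivatives along the curve in powers of `h` (`isBigO_sub_nodeMap`), gives
a recursion for the `e_i`: the inhomogeneous terms are the defects `ψ_{k,i}` applied to derivatives of
`N ∘ u`, and the other terms apply `a_{ij}(h L)` to multilinear maps in the earlier errors. Since the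
stages are explicit, unwinding the recursion produces a finite family of trees
(`Method.exists_tree_expansion`), and the local error is the corresponding sum over trees up to
`O(h^(p+1))`. All powers of `h` are absorbed in the vectors and multilinear maps, so a tree
contributes `O(h^order)`; trees of order at most `p` contribute nothing by the stiff order conditions,
and the others are of the required size (`Method.isBigO_of_stiffOrder`).

The estimates are uniform in the grid points. To have the calculus of `O`-terms at hand, they are
stated along a filter on pairs `(h, t)` (`gridFilter`).
-/

noncomputable section

namespace IMEXP

open Set Asymptotics

/-! ### Strongly continuous semigroups -/

section

variable {X : Type*} [NormedAddCommGroup X] [NormedSpace ℝ X] {S : ℝ → X →L[ℝ] X}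

namespace IsC0Semigroup

theorem exists_norm_le [CompleteSpace X] (hS : IsC0Semigroup S) (b : ℝ) :
    ∃ K : ℝ, 0 ≤ K ∧ ∀ t ∈ Icc 0 b, ‖S t‖ ≤ K := by
  obtain ⟨K, hK⟩ := banach_steinhaus (g := fun t : Icc (0 : ℝ) b => S t) fun x => by
    obtain ⟨C, hC⟩ := isCompact_Icc.exists_bound_of_continuousOn
      ((hS.continuousOn x).mono (Icc_subset_Ici_self : Icc 0 b ⊆ Ici 0))
    exact ⟨C, fun t => hC t t.2⟩
  exact ⟨max K 0, le_max_right _ _, fun t ht => (hK ⟨t, ht⟩).trans (le_max_left _ _)⟩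

/-- Joint continuity of `(t, x) ↦ S t x`, in terms of limits. -/
theorem tendsto_apply [CompleteSpace X] (hS : IsC0Semigroup S) {α : Type*} {l : Filter α}
    {r : α → ℝ} {g : α → X} {r₀ : ℝ} {g₀ : X} (hr₀ : 0 ≤ r₀) (hr : Tendsto r l (𝓝 r₀))
    (hr' : ∀ᶠ a in l, 0 ≤ r a) (hg : Tendsto g l (𝓝 g₀)) :
    Tendsto (fun a => S (r a) (g a)) l (𝓝 (S r₀ g₀)) := by
  obtain ⟨K, hK, hSK⟩ := hS.exists_norm_le (r₀ + 1)
  have h1 : Tendsto (fun a => S (r a) g₀) l (𝓝 (S r₀ g₀)) :=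
    (hS.continuousOn g₀ r₀ hr₀).tendsto.comp
      (tendsto_nhdsWithin_iff.2 ⟨hr, hr'⟩)
  have h2 : Tendsto (fun a => S (r a) (g a - g₀)) l (𝓝 0) := by
    have h3 : Tendsto (fun a => K * ‖g a - g₀‖) l (𝓝 0) := by
      have := (tendsto_iff_norm_sub_tendsto_zero.1 hg).const_mul K
      simpa using this
    refine squeeze_zero_norm' ?_ h3
    filter_upwards [hr', hr.eventually (gt_mem_nhds (lt_add_one r₀))] with a ha ha'
    exact (S (r a)).le_of_opNorm_le (hSK _ ⟨ha, ha'.le⟩) _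
  have := h2.add h1
  simpa using this

theorem continuousOn_apply [CompleteSpace X] (hS : IsC0Semigroup S) {α : Type*}
    [TopologicalSpace α] {s : Set α} {r : α → ℝ} {g : α → X} (hr : ContinuousOn r s)
    (hr' : ∀ a ∈ s, 0 ≤ r a) (hg : ContinuousOn g s) :
    ContinuousOn (fun a => S (r a) (g a)) s := fun a ha =>
  hS.tendsto_apply (hr' a ha) (hr a ha) (eventually_nhdsWithin_of_forall hr') (hg a ha)

end IsC0Semigroup

/-- The variation-of-constants formula: it suffices that the right derivative of `y` minus `L y`
agrees with a continuous function, because the semigroup property turns the difference quotient of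
`s ↦ S (h - s) (y s)` into `S (h - r)` applied to difference quotients at `y s`. -/
theorem IsGenerator.variation_of_constants [CompleteSpace X] {L : X →ₗ.[ℝ] X}
    (hL : IsGenerator S L) (hS : IsC0Semigroup S) {y g : ℝ → X} {h : ℝ} (hh : 0 ≤ h)
    (hy : ContinuousOn y (Icc 0 h)) (hg : ContinuousOn g (Icc 0 h))
    (hdom : ∀ s ∈ Ioo 0 h, y s ∈ L.domain)
    (hy' : ∀ s ∈ Ioo 0 h, HasDerivWithinAt y (opApply L (y s) + g s) (Ioi s) s) :
    y h - S h (y 0) = ∫ s in (0 : ℝ)..h, S (h - s) (g s) := by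
  have hcont : ∀ {g : ℝ → X}, ContinuousOn g (Icc 0 h) →
      ContinuousOn (fun s => S (h - s) (g s)) (Icc 0 h) := fun hg =>
    hS.continuousOn_apply (by fun_prop) (fun s hs => sub_nonneg.2 hs.2) hg
  have key := intervalIntegral.integral_eq_sub_of_hasDeriv_right_of_le
    (f := fun s => S (h - s) (y s)) (f' := fun s => S (h - s) (g s)) hh (hcont hy) ?_ ?_
  · rw [key]; simp [hS.map_zero]
  · intro s hs
    rw [hasDerivWithinAt_iff_tendsto_slope' (by simp)]
    have h1 := hasDerivWithinAt_iff_tendsto_slope' (by simp) |>.1 (hy' s hs)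
    have h2 : Tendsto (fun r : ℝ => (r - s)⁻¹ • (S (r - s) (y s) - y s)) (𝓝[>] s)
        (𝓝 (opApply L (y s))) := by
      have h3 := hL.tendsto ⟨y s, hdom s hs⟩
      have h4 : opApply L (y s) = L ⟨y s, hdom s hs⟩ := by simp [opApply, hdom s hs]
      rw [h4]
      refine h3.comp (tendsto_nhdsWithin_iff.2 ⟨?_, ?_⟩)
      · have : Tendsto (fun r : ℝ => r - s) (𝓝 s) (𝓝 (s - s)) :=
          Continuous.tendsto (by fun_prop) s
        rw [sub_self] at this
        exact this.mono_left nhdsWithin_le_nhds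
      · filter_upwards [self_mem_nhdsWithin] with r hr
        exact sub_pos.2 (mem_Ioi.1 hr)
    have h5 : Tendsto (fun r => slope y s r - (r - s)⁻¹ • (S (r - s) (y s) - y s)) (𝓝[>] s)
        (𝓝 (g s)) := by
      have := h1.sub h2
      simpa using this
    have hlt : ∀ᶠ r in 𝓝[>] s, r < h := nhdsWithin_le_nhds (gt_mem_nhds hs.2)
    have h6 := hS.tendsto_apply (r := fun r => h - r) (r₀ := h - s) (sub_nonneg.2 hs.2.le)
      ((Continuous.tendsto (by fun_prop : Continuous fun r => h - r) s).mono_left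
        nhdsWithin_le_nhds) (hlt.mono fun r hr => sub_nonneg.2 hr.le) h5
    refine h6.congr' ?_
    filter_upwards [hlt, self_mem_nhdsWithin] with r hr hr'
    have h7 : S (h - s) (y s) = S (h - r) (S (r - s) (y s)) := by
      rw [← ContinuousLinearMap.comp_apply,
        ← hS.map_add _ _ (sub_nonneg.2 hr.le) (sub_nonneg.2 (le_of_lt hr'))]
      congr 2; ring
    simp only [slope_def_module, h7]
    rw [← smul_sub, map_smul, ← map_sub]
    congr 2
    abel
  · exact (hcont hg).intervalIntegrable_of_Icc hh

/-- For `x` in the domain of the generator, `S σ x - x` is the integral of `S s (L x)`. -/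
theorem IsGenerator.apply_sub_eq_integral [CompleteSpace X] {L : X →ₗ.[ℝ] X}
    (hL : IsGenerator S L) (hS : IsC0Semigroup S) {x : X} (hx : x ∈ L.domain) {σ : ℝ}
    (hσ : 0 ≤ σ) : S σ x - x = ∫ s in (0 : ℝ)..σ, S s (opApply L x) := by
  have := hL.variation_of_constants hS (y := fun _ => x) (g := fun _ => -opApply L x) hσ
    continuousOn_const continuousOn_const (fun _ _ => hx)
    (fun s _ => by simpa using hasDerivWithinAt_const s (Ioi s) x)
  rw [← neg_sub, this]
  simp [intervalIntegral.integral_comp_sub_left (fun s => S s (opApply L x))]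

/-! ### The `φ`-functions as bounded operators -/

theorem continuousOn_phi_integrand [CompleteSpace X] (hS : IsC0Semigroup S) (k : ℕ) {t : ℝ}
    (ht : 0 ≤ t) (x : X) :
    ContinuousOn (fun θ : ℝ => (θ ^ k / (k.factorial : ℝ)) • S ((1 - θ) * t) x) (Icc 0 1) :=
  ContinuousOn.smul (by fun_prop) (hS.continuousOn_apply (by fun_prop)
    (fun θ hθ => mul_nonneg (sub_nonneg.2 hθ.2) ht) continuousOn_const)

theorem phi_add [CompleteSpace X] (hS : IsC0Semigroup S) (k : ℕ) {t : ℝ} (ht : 0 ≤ t) (x y : X) :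
    phi S k t (x + y) = phi S k t x + phi S k t y := by
  cases k with
  | zero => simp [phi]
  | succ k =>
    simp only [phi, map_add, smul_add]
    exact intervalIntegral.integral_add
      ((continuousOn_phi_integrand hS k ht x).intervalIntegrable_of_Icc zero_le_one)
      ((continuousOn_phi_integrand hS k ht y).intervalIntegrable_of_Icc zero_le_one)

theorem phi_smul (k : ℕ) (t r : ℝ) (x : X) : phi S k t (r • x) = r • phi S k t x := by
  cases k with
  | zero => simp [phi]
  | succ k =>
    simp only [phi, map_smul]
    rw [← intervalIntegral.integral_smul]
    simp only [smul_comm r]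

theorem norm_phi_le (k : ℕ) {t K : ℝ} (ht : 0 ≤ t) (hK : ∀ s ∈ Icc 0 t, ‖S s‖ ≤ K) (x : X) :
    ‖phi S k t x‖ ≤ K * ‖x‖ := by
  cases k with
  | zero => exact (S t).le_of_opNorm_le (hK t ⟨ht, le_rfl⟩) x
  | succ k =>
    have := intervalIntegral.norm_integral_le_of_norm_le_const (a := 0) (b := 1)
      (f := fun θ : ℝ => (θ ^ k / (k.factorial : ℝ)) • S ((1 - θ) * t) x) (C := K * ‖x‖) ?_
    · simpa [phi] using this
    · intro θ hθ
      rw [uIoc_of_le zero_le_one] at hθ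
      have h1 : ‖S ((1 - θ) * t) x‖ ≤ K * ‖x‖ :=
        (S _).le_of_opNorm_le (hK _ ⟨mul_nonneg (sub_nonneg.2 hθ.2) ht,
          mul_le_of_le_one_left ht (by linarith [hθ.1])⟩) x
      have h2 : ‖θ ^ k / (k.factorial : ℝ)‖ ≤ 1 := by
        rw [norm_div, norm_pow, Real.norm_of_nonneg hθ.1.le, Real.norm_natCast]
        exact div_le_one_of_le₀ ((pow_le_one₀ hθ.1.le hθ.2).trans
          (by exact_mod_cast k.factorial_pos)) (Nat.cast_nonneg _)
      rw [norm_smul]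
      exact (mul_le_of_le_one_left (norm_nonneg _) h2).trans h1

/-- `φ_k(t L)` as a bounded operator. The time is cut off at `0`, so that this is total in `t`. -/
def phiCLM [CompleteSpace X] (hS : IsC0Semigroup S) (k : ℕ) (t : ℝ) : X →L[ℝ] X :=
  LinearMap.mkContinuousOfExistsBound
    { toFun := phi S k (max t 0)
      map_add' := phi_add hS k (le_max_right _ _)
      map_smul' := phi_smul k _ }
    (by
      obtain ⟨K, -, hK⟩ := hS.exists_norm_le (max t 0)
      exact ⟨K, norm_phi_le k (le_max_right _ _) hK⟩)

theorem phiCLM_apply [CompleteSpace X] (hS : IsC0Semigroup S) (k : ℕ) {t : ℝ} (ht : 0 ≤ t)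
    (x : X) : phiCLM hS k t x = phi S k t x := by
  change phi S k (max t 0) x = _
  rw [max_eq_left ht]

theorem exists_norm_phiCLM_le [CompleteSpace X] (hS : IsC0Semigroup S) (b : ℝ) :
    ∃ K : ℝ, 0 ≤ K ∧ ∀ k, ∀ t ∈ Icc 0 b, ‖phiCLM hS k t‖ ≤ K := by
  obtain ⟨K, hK0, hK⟩ := hS.exists_norm_le b
  refine ⟨K, hK0, fun k t ht => ContinuousLinearMap.opNorm_le_bound _ hK0 fun x => ?_⟩
  rw [phiCLM_apply hS k ht.1]
  exact norm_phi_le k ht.1 (fun s hs => hK s ⟨hs.1, hs.2.trans ht.2⟩) x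

/-- `f(h L)` as a bounded operator, for a linear combination `f` of `φ`-functions. -/
def PhiComb.clm [CompleteSpace X] (f : PhiComb) (hS : IsC0Semigroup S) (h : ℝ) : X →L[ℝ] X :=
  f.sum fun kγ r => r • phiCLM hS kγ.1 ((kγ.2 : ℝ) * h)

theorem PhiComb.clm_apply [CompleteSpace X] (f : PhiComb) (hS : IsC0Semigroup S) {h : ℝ}
    (hh : 0 ≤ h) (x : X) : f.clm hS h x = f.apply S h x := by
  simp only [PhiComb.clm, PhiComb.apply, Finsupp.sum, sum_apply, smul_apply]
  exact Finset.sum_congr rfl fun kγ _ => by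
    rw [phiCLM_apply hS _ (mul_nonneg kγ.2.coe_nonneg hh)]

theorem PhiComb.exists_norm_clm_le [CompleteSpace X] (f : PhiComb) (hS : IsC0Semigroup S) :
    ∃ K : ℝ, 0 ≤ K ∧ ∀ h ∈ Icc (0 : ℝ) 1, ‖f.clm hS h‖ ≤ K := by
  choose K hK0 hK using exists_norm_phiCLM_le hS
  refine ⟨∑ kγ ∈ f.support, ‖f kγ‖ * K kγ.2,
    Finset.sum_nonneg fun kγ _ => mul_nonneg (norm_nonneg _) (hK0 _), fun h hh => ?_⟩
  refine (norm_sum_le f.support _).trans (Finset.sum_le_sum fun kγ _ => ?_)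
  rw [norm_smul]
  exact mul_le_mul_of_nonneg_left (hK _ _ _ ⟨mul_nonneg kγ.2.coe_nonneg hh.1,
    mul_le_of_le_one_right kγ.2.coe_nonneg hh.2⟩) (norm_nonneg _)

/-- Moments of the semigroup are `φ`-functions. -/
theorem integral_pow_smul_apply (k : ℕ) (h : ℝ) (w : X) :
    ∫ s in (0 : ℝ)..h, (s ^ k / (k.factorial : ℝ)) • S (h - s) w
      = h ^ (k + 1) • phi S (k + 1) h w := by
  have h1 := intervalIntegral.smul_integral_comp_mul_left (a := 0) (b := 1)
    (fun s : ℝ => (s ^ k / (k.factorial : ℝ)) • S (h - s) w) h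
  rw [mul_zero, mul_one] at h1
  rw [← h1, phi, ← intervalIntegral.integral_smul, ← intervalIntegral.integral_smul]
  refine intervalIntegral.integral_congr fun θ _ => ?_
  rw [show h - h * θ = (1 - θ) * h by ring, smul_smul, smul_smul]
  congr 1
  ring

theorem integral_apply_eq_smul_phi (h : ℝ) (w : X) :
    ∫ s in (0 : ℝ)..h, S s w = h • phi S 1 h w := by
  have := integral_pow_smul_apply (S := S) 0 h w
  simp only [pow_zero, Nat.factorial_zero, Nat.cast_one, div_one, one_smul, zero_add,
    pow_one] at this
  rw [← this, intervalIntegral.integral_comp_sub_left (fun s => S s w)]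
  simp

/-- The recurrence `φ_k(z) = 1 / k! + z φ_{k+1}(z)`. The relation `L x = z` enters in its integrated
form `S s x - x = ∫_0^s S r z dr`. -/
theorem phi_eq_add_smul_phi_succ [CompleteSpace X] (hS : IsC0Semigroup S) {x z : X}
    (hxz : ∀ s, 0 ≤ s → S s x - x = ∫ r in (0 : ℝ)..s, S r z) (k : ℕ) {t : ℝ} (ht : 0 ≤ t) :
    phi S k t x = (k.factorial : ℝ)⁻¹ • x + t • phi S (k + 1) t z := by
  cases k with
  | zero =>
    have := hxz t ht
    rw [integral_apply_eq_smul_phi, sub_eq_iff_eq_add'] at this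
    simpa [phi] using this
  | succ k =>
    have hc : ContinuousOn (fun θ : ℝ =>
        t • (θ ^ (k + 1) / ((k + 1).factorial : ℝ)) • S ((1 - θ) * t) z) (Icc 0 1) :=
      (continuousOn_phi_integrand hS (k + 1) ht z).const_smul t
    have hd : ∀ s, 0 < s → HasDerivAt (fun s => S s x) (S s z) s := by
      intro s hs
      have hcz : ContinuousOn (fun r => S r z) (Ici 0) := hS.continuousOn z
      have hcs : ContinuousAt (fun r => S r z) s := hcz.continuousAt (Ici_mem_nhds hs)
      have h1 : HasDerivAt (fun s => x + ∫ r in (0 : ℝ)..s, S r z) (S s z) s := by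
        refine HasDerivAt.const_add _ (intervalIntegral.integral_hasDerivAt_right
          ((hcz.mono Icc_subset_Ici_self).intervalIntegrable_of_Icc hs.le) ?_ hcs)
        exact (hcz.mono Ioi_subset_Ici_self).stronglyMeasurableAtFilter isOpen_Ioi s hs
      refine h1.congr_of_eventuallyEq ?_
      filter_upwards [lt_mem_nhds hs] with r hr
      rw [← hxz r hr.le]; abel
    -- for `t = 0` the argument of `S` is the boundary point `0`, which `hd` does not cover
    rcases ht.eq_or_lt with rfl | ht'
    · simp only [phi, mul_zero, zero_smul, add_zero, hS.map_zero, ContinuousLinearMap.id_apply]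
      rw [intervalIntegral.integral_smul_const, intervalIntegral.integral_div, integral_pow,
        Nat.factorial_succ]
      congr 1
      push_cast
      field_simp
      simp
    have key := intervalIntegral.integral_eq_sub_of_hasDerivAt_of_le zero_le_one
      (f := fun θ : ℝ => (θ ^ (k + 1) / ((k + 1).factorial : ℝ)) • S ((1 - θ) * t) x)
      (f' := fun θ : ℝ => (θ ^ k / (k.factorial : ℝ)) • S ((1 - θ) * t) x
        - t • (θ ^ (k + 1) / ((k + 1).factorial : ℝ)) • S ((1 - θ) * t) z)
      (continuousOn_phi_integrand hS (k + 1) ht x) ?_ ?_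
    · rw [intervalIntegral.integral_sub
        ((continuousOn_phi_integrand hS k ht x).intervalIntegrable_of_Icc zero_le_one)
        (hc.intervalIntegrable_of_Icc zero_le_one),
        intervalIntegral.integral_smul, sub_eq_iff_eq_add] at key
      simp only [phi]
      rw [key]
      simp [hS.map_zero]
    · intro θ hθ
      have h1 : HasDerivAt (fun θ : ℝ => (1 - θ) * t) (-t) θ := by
        simpa using ((hasDerivAt_id θ).const_sub 1).mul_const t
      have h2 : HasDerivAt (fun θ : ℝ => S ((1 - θ) * t) x) ((-t) • S ((1 - θ) * t) z) θ :=
        HasDerivAt.scomp (g₁ := fun s => S s x) θ (hd _ (mul_pos (sub_pos.2 hθ.2) ht')) h1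
      have h3 : HasDerivAt (fun θ : ℝ => θ ^ (k + 1) / ((k + 1).factorial : ℝ))
          (θ ^ k / (k.factorial : ℝ)) θ := by
        have := (hasDerivAt_pow (k + 1) θ).div_const ((k + 1).factorial : ℝ)
        refine this.congr_deriv ?_
        rw [Nat.factorial_succ]
        push_cast
        have : (k.factorial : ℝ) ≠ 0 := by exact_mod_cast k.factorial_ne_zero
        field_simp
      refine (h3.smul h2).congr_deriv ?_
      rw [smul_comm, neg_smul, add_comm, ← sub_eq_add_neg]
    · exact ((continuousOn_phi_integrand hS k ht x).sub
        hc).intervalIntegrable_of_Icc zero_le_one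

end

/-! ### Taylor expansions -/

section Calculus

variable {E Y : Type*} [NormedAddCommGroup E] [NormedSpace ℝ E]
  [NormedAddCommGroup Y] [NormedSpace ℝ Y]

/-- A `C^p` function on a compact interval extends to a `C^p` function on the line: extend the
derivative and integrate. -/
theorem exists_contDiff_eqOn_Icc [CompleteSpace E] {a b : ℝ} (hab : a < b) (p : ℕ) {u : ℝ → E}
    (hu : ContDiffOn ℝ p u (Icc a b)) : ∃ v : ℝ → E, ContDiff ℝ p v ∧ EqOn v u (Icc a b) := by
  induction p generalizing u with
  | zero =>
    refine ⟨IccExtend hab.le ((Icc a b).domRestrict u), ?_, fun t ht => ?_⟩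
    · rw [Nat.cast_zero, contDiff_zero]
      exact (continuousOn_iff_continuous_domRestrict.1 hu.continuousOn).Icc_extend'
    · rw [IccExtend_of_mem _ _ ht]
      rfl
  | succ p ih =>
    rw [Nat.cast_add, Nat.cast_one, contDiffOn_succ_iff_derivWithin (uniqueDiffOn_Icc hab)] at hu
    obtain ⟨g, hg, hgu⟩ := ih hu.2.2
    have hd : ∀ s, HasDerivAt (fun s => u a + ∫ r in a..s, g r) (g s) s := fun s =>
      (intervalIntegral.integral_hasDerivAt_right (hg.continuous.intervalIntegrable _ _)
        hg.continuous.aestronglyMeasurable.stronglyMeasurableAtFilter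
        hg.continuous.continuousAt).const_add _
    refine ⟨fun s => u a + ∫ r in a..s, g r, ?_, fun t ht => ?_⟩
    · rw [Nat.cast_add, Nat.cast_one, contDiff_succ_iff_deriv]
      refine ⟨fun s => (hd s).differentiableAt, by simp, ?_⟩
      rwa [show deriv (fun s => u a + ∫ r in a..s, g r) = g from funext fun s => (hd s).deriv]
    · have hsub : Icc a t ⊆ Icc a b := Icc_subset_Icc_right ht.2
      have key := intervalIntegral.integral_eq_sub_of_hasDerivAt_of_le ht.1
        (f := u) (f' := g) (hu.1.continuousOn.mono hsub) ?_ (hg.continuous.intervalIntegrable _ _)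
      · simp only [key]
        abel
      · intro s hs
        have hs' : s ∈ Icc a b := hsub (Ioo_subset_Icc_self hs)
        rw [hgu hs']
        exact (hu.1 s hs').hasDerivWithinAt.hasDerivAt
          (Icc_mem_nhds hs.1 (hs.2.trans_le ht.2))

/-- Taylor's estimate for a function `f 0` with successive derivatives `f 1, …, f n`. -/
theorem norm_sub_taylor_le {f : ℕ → ℝ → Y} {n : ℕ} {b C : ℝ}
    (hf : ∀ k < n, ∀ s ∈ Icc 0 b, HasDerivWithinAt (f k) (f (k + 1) s) (Icc 0 b) s)
    (hC : ∀ s ∈ Icc 0 b, ‖f n s‖ ≤ C) {s : ℝ} (hs : s ∈ Icc 0 b) :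
    ‖f 0 s - ∑ k ∈ Finset.range n, (s ^ k / (k.factorial : ℝ)) • f k 0‖ ≤ C * s ^ n := by
  induction n generalizing f s with
  | zero => simpa using hC s hs
  | succ n ih =>
    have hC0 : 0 ≤ C := (norm_nonneg _).trans (hC s hs)
    have h1 : ∀ r ∈ Icc 0 b, ‖f 1 r - ∑ k ∈ Finset.range n,
        (r ^ k / (k.factorial : ℝ)) • f (k + 1) 0‖ ≤ C * r ^ n := fun r hr =>
      ih (f := fun k => f (k + 1)) (fun k hk => hf (k + 1) (by omega)) hC hr
    have h2 : ∀ r ∈ Icc 0 s, HasDerivWithinAt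
        (fun r => f 0 r - ∑ k ∈ Finset.range (n + 1), (r ^ k / (k.factorial : ℝ)) • f k 0)
        (f 1 r - ∑ k ∈ Finset.range n, (r ^ k / (k.factorial : ℝ)) • f (k + 1) 0)
        (Icc 0 s) r := by
      intro r hr
      refine ((hf 0 n.succ_pos r ⟨hr.1, hr.2.trans hs.2⟩).mono
        (Icc_subset_Icc_right hs.2)).sub ?_
      simp only [Finset.sum_range_succ' _ n]
      refine HasDerivAt.hasDerivWithinAt ?_
      rw [← add_zero (∑ k ∈ Finset.range n, (r ^ k / (k.factorial : ℝ)) • f (k + 1) 0)]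
      refine HasDerivAt.add (HasDerivAt.fun_sum fun k _ => ?_) ?_
      · have h3 := ((hasDerivAt_pow (k + 1) r).div_const ((k + 1).factorial : ℝ)).smul_const
          (f (k + 1) 0)
        refine h3.congr_deriv ?_
        congr 1
        rw [Nat.factorial_succ]
        push_cast
        have : (k.factorial : ℝ) ≠ 0 := by exact_mod_cast k.factorial_ne_zero
        field_simp
      · simpa using hasDerivAt_const r (f 0 0)
    have h4 := norm_image_sub_le_of_norm_deriv_le_segment' h2 (C := C * s ^ n)
      (fun r hr => (h1 r ⟨hr.1, hr.2.le.trans hs.2⟩).trans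
        (mul_le_mul_of_nonneg_left (pow_le_pow_left₀ hr.1 hr.2.le n) hC0)) s ⟨hs.1, le_rfl⟩
    have h5 : f 0 0 - ∑ k ∈ Finset.range (n + 1), ((0 : ℝ) ^ k / (k.factorial : ℝ)) • f k 0 = 0 := by
      rw [Finset.sum_range_succ']
      simp
    rw [h5, sub_zero, sub_zero] at h4
    rwa [pow_succ, ← mul_assoc]

theorem hasDerivAt_iteratedDeriv {f : ℝ → Y} {n : ℕ} {t : ℝ} (hf : ContDiffAt ℝ n f t) {k : ℕ}
    (hk : k < n) : HasDerivAt (iteratedDeriv k f) (iteratedDeriv (k + 1) f t) t := by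
  rw [iteratedDeriv_succ]
  refine DifferentiableAt.hasDerivAt ?_
  rw [iteratedDeriv_eq_equiv_comp]
  exact (LinearIsometryEquiv.differentiable _).differentiableAt.comp t
    (hf.differentiableAt_iteratedFDeriv (by exact_mod_cast hk))

theorem continuousAt_iteratedDeriv {f : ℝ → Y} {n : ℕ} {t : ℝ} (hf : ContDiffAt ℝ n f t) {k : ℕ}
    (hk : k ≤ n) : ContinuousAt (iteratedDeriv k f) t := by
  rw [iteratedDeriv_eq_equiv_comp]
  exact (LinearIsometryEquiv.continuous _).continuousAt.comp
    (hf.continuousAt_iteratedFDeriv (by exact_mod_cast hk))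

theorem exists_norm_iteratedDeriv_le {f : ℝ → Y} {n : ℕ} {a b : ℝ}
    (hf : ∀ t ∈ Icc a b, ContDiffAt ℝ n f t) {k : ℕ} (hk : k ≤ n) :
    ∃ C : ℝ, ∀ t ∈ Icc a b, ‖iteratedDeriv k f t‖ ≤ C :=
  isCompact_Icc.exists_bound_of_continuousOn fun t ht =>
    (continuousAt_iteratedDeriv (hf t ht) hk).continuousWithinAt

/-- Taylor expansion on a compact interval, uniform in the base point. -/
theorem exists_norm_sub_taylor_le {f : ℝ → Y} {n : ℕ} {a b : ℝ}
    (hf : ∀ t ∈ Icc a b, ContDiffAt ℝ n f t) :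
    ∃ C : ℝ, ∀ t ∈ Icc a b, ∀ τ, 0 ≤ τ → t + τ ≤ b →
      ‖f (t + τ) - ∑ k ∈ Finset.range n, (τ ^ k / (k.factorial : ℝ)) • iteratedDeriv k f t‖
        ≤ C * τ ^ n := by
  obtain ⟨C, hC⟩ := exists_norm_iteratedDeriv_le hf le_rfl
  refine ⟨C, fun t ht τ hτ hτb => ?_⟩
  have hmem : ∀ s ∈ Icc 0 τ, t + s ∈ Icc a b := fun s hs =>
    ⟨by linarith [ht.1, hs.1], by linarith [hs.2]⟩
  have := norm_sub_taylor_le (f := fun k s => iteratedDeriv k f (t + s)) (n := n) (b := τ) (C := C)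
    (fun k hk s hs => ((hasDerivAt_iteratedDeriv (hf _ (hmem s hs)) hk).comp_const_add
      t s).hasDerivWithinAt) (fun s hs => hC _ (hmem s hs)) (s := τ) ⟨hτ, le_rfl⟩
  simpa using this

/-- Taylor expansion of a function of several variables along a segment. -/
theorem norm_sub_taylor_iteratedFDeriv_le {f : E → Y} {n : ℕ} {C : ℝ} {x e : E}
    (hf : ∀ s ∈ Icc (0 : ℝ) 1, ContDiffAt ℝ n f (x + s • e))
    (hC : ∀ s ∈ Icc (0 : ℝ) 1, ‖iteratedFDeriv ℝ n f (x + s • e)‖ ≤ C) :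
    ‖f (x + e) - ∑ m ∈ Finset.range n, (m.factorial : ℝ)⁻¹ • iteratedFDeriv ℝ m f x fun _ => e‖
      ≤ C * ‖e‖ ^ n := by
  have := norm_sub_taylor_le (f := fun m s => iteratedFDeriv ℝ m f (x + s • e) fun _ => e)
    (n := n) (b := 1) (C := C * ‖e‖ ^ n) ?_ ?_ (s := 1) ⟨zero_le_one, le_rfl⟩
  · simpa using this
  · intro m hm s hs
    have h1 : HasDerivAt (fun s : ℝ => x + s • e) e s := by
      simpa using ((hasDerivAt_id s).smul_const e).const_add x
    have h2 := ((hf s hs).differentiableAt_iteratedFDeriv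
      (m := m) (by exact_mod_cast hm)).hasFDerivAt.comp_hasDerivAt s h1
    have h3 := ((ContinuousMultilinearMap.apply ℝ (fun _ : Fin m => E) Y
      fun _ => e).hasFDerivAt).comp_hasDerivAt s h2
    exact h3.hasDerivWithinAt
  · intro s hs
    refine (ContinuousMultilinearMap.le_of_opNorm_le (hC s hs) _).trans ?_
    simp

end Calculus

/-! ### Uniform estimates along the grid points -/

section

variable {X : Type*} [NormedAddCommGroup X] [NormedSpace ℝ X] {S : ℝ → X →L[ℝ] X} {t₀ T : ℝ}

/-- The filter on pairs `(h, t)` that expresses `h → 0+`, uniformly in the grid points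
`t = t₀ + n h` with `t + h ≤ T`. -/
def gridFilter (t₀ T : ℝ) : Filter (ℝ × ℝ) :=
  comap Prod.fst (𝓝[>] 0) ⊓ 𝓟 {x | ∃ n : ℕ, x.2 = t₀ + n * x.1 ∧ x.2 + x.1 ≤ T}

theorem eventually_gridFilter_fst {P : ℝ → Prop} (h : ∀ᶠ h in 𝓝[>] (0 : ℝ), P h) :
    ∀ᶠ x in gridFilter t₀ T, P x.1 :=
  Filter.Eventually.filter_mono inf_le_left (h.comap Prod.fst)

theorem eventually_gridFilter_pos : ∀ᶠ x in gridFilter t₀ T, 0 < x.1 :=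
  eventually_gridFilter_fst self_mem_nhdsWithin

theorem eventually_gridFilter_le {ε : ℝ} (hε : 0 < ε) : ∀ᶠ x in gridFilter t₀ T, x.1 ≤ ε :=
  eventually_gridFilter_fst (nhdsWithin_le_nhds (Iic_mem_nhds hε))

theorem eventually_gridFilter_mem :
    ∀ᶠ x in gridFilter t₀ T, x.2 ∈ Icc t₀ T ∧ x.2 + x.1 ≤ T := by
  have h1 : ∀ᶠ x in gridFilter t₀ T, ∃ n : ℕ, x.2 = t₀ + n * x.1 ∧ x.2 + x.1 ≤ T :=
    Filter.Eventually.filter_mono inf_le_right (mem_principal_self _)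
  filter_upwards [h1, eventually_gridFilter_pos] with x hx hx0
  obtain ⟨n, hn, hT⟩ := hx
  exact ⟨⟨by rw [hn]; nlinarith [(Nat.cast_nonneg n : (0 : ℝ) ≤ n)], by linarith⟩, hT⟩

theorem isUniformO_iff_isBigO {Z : Type*} [NormedAddCommGroup Z] {q : ℕ} {g : ℝ → ℝ → Z} :
    IsUniformO t₀ T q g ↔
      (fun x => g x.1 x.2) =O[gridFilter t₀ T] fun x => x.1 ^ q := by
  have key : ∀ C : ℝ, (∀ᶠ h in 𝓝[>] (0 : ℝ), ∀ n : ℕ, t₀ + n * h + h ≤ T →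
      ‖g h (t₀ + n * h)‖ ≤ C * h ^ q) ↔
      ∀ᶠ x in gridFilter t₀ T, ‖g x.1 x.2‖ ≤ C * x.1 ^ q := by
    intro C
    rw [gridFilter, eventually_inf_principal, eventually_comap]
    refine eventually_congr (Eventually.of_forall fun h => ⟨?_, ?_⟩)
    · rintro hh ⟨h', t⟩ (rfl : h' = h) ⟨n, (rfl : t = t₀ + n * h'), hT⟩
      exact hh n hT
    · exact fun hh n hT => hh (h, t₀ + n * h) rfl ⟨n, rfl, hT⟩
  rw [IsUniformO, isBigO_iff]
  refine exists_congr fun C => (key C).trans (eventually_congr ?_)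
  filter_upwards [eventually_gridFilter_pos] with x hx
  rw [Real.norm_of_nonneg (pow_nonneg hx.le q)]

theorem isBigO_pow_of_le {m n : ℕ} (h : m ≤ n) :
    (fun x : ℝ × ℝ => x.1 ^ n) =O[gridFilter t₀ T] fun x => x.1 ^ m := by
  refine IsBigO.of_bound 1 ?_
  filter_upwards [eventually_gridFilter_pos, eventually_gridFilter_le one_pos] with x hx hx1
  rw [one_mul, Real.norm_of_nonneg (pow_nonneg hx.le _), Real.norm_of_nonneg (pow_nonneg hx.le _)]
  exact pow_le_pow_of_le_one hx.le hx1 h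

theorem tendsto_zero_of_isBigO_pow {Z : Type*} [NormedAddCommGroup Z] {g : ℝ × ℝ → Z}
    {n : ℕ} (hn : 1 ≤ n)
    (hg : g =O[gridFilter t₀ T] fun x => x.1 ^ n) : Tendsto g (gridFilter t₀ T) (𝓝 0) := by
  refine (hg.trans (isBigO_pow_of_le hn)).trans_tendsto ?_
  simp only [pow_one]
  exact ((tendsto_id'.2 nhdsWithin_le_nhds : Tendsto id (𝓝[>] (0 : ℝ)) (𝓝 0)).comp
    tendsto_comap).mono_left inf_le_left

theorem isBigO_one_of_continuousOn {Z : Type*} [NormedAddCommGroup Z] {g : ℝ → Z}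
    (hg : ContinuousOn g (Icc t₀ T)) :
    (fun x => g x.2) =O[gridFilter t₀ T] fun x => x.1 ^ 0 := by
  obtain ⟨C, hC⟩ := isCompact_Icc.exists_bound_of_continuousOn hg
  refine IsBigO.of_bound C ?_
  filter_upwards [eventually_gridFilter_mem] with x hx
  simpa using hC _ hx.1

theorem eventually_mem_ball {Z : Type*} [NormedAddCommGroup Z] {v : ℝ → Z} {δ : ℝ}
    {z : ℝ × ℝ → Z} (hδ : 0 < δ)
    (hz : Tendsto (fun x => z x - v x.2) (gridFilter t₀ T) (𝓝 0)) :
    ∀ᶠ x in gridFilter t₀ T, z x ∈ Metric.ball (v x.2) δ := by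
  filter_upwards [hz.eventually (Metric.ball_mem_nhds 0 hδ)] with x hx
  simpa [dist_eq_norm] using hx

theorem isBigO_phi [CompleteSpace X] (hS : IsC0Semigroup S) (k : ℕ) {c : ℝ} (hc : 0 ≤ c)
    {g : ℝ × ℝ → X} {b : ℝ × ℝ → ℝ} (hg : g =O[gridFilter t₀ T] b) :
    (fun x => phi S k (c * x.1) (g x)) =O[gridFilter t₀ T] b := by
  obtain ⟨K, -, hK⟩ := exists_norm_phiCLM_le hS c
  refine (IsBigO.of_bound K ?_).trans hg
  filter_upwards [eventually_gridFilter_pos, eventually_gridFilter_le one_pos] with x hx hx1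
  have h0 : 0 ≤ c * x.1 := mul_nonneg hc hx.le
  rw [← phiCLM_apply hS k h0]
  exact (phiCLM hS k _).le_of_opNorm_le (hK k _ ⟨h0, mul_le_of_le_one_right hc hx1⟩) _

theorem PhiComb.isBigO_apply [CompleteSpace X] (f : PhiComb) (hS : IsC0Semigroup S)
    {g : ℝ × ℝ → X} {b : ℝ × ℝ → ℝ} (hg : g =O[gridFilter t₀ T] b) :
    (fun x => f.apply S x.1 (g x)) =O[gridFilter t₀ T] b := by
  obtain ⟨K, -, hK⟩ := f.exists_norm_clm_le hS
  refine (IsBigO.of_bound K ?_).trans hg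
  filter_upwards [eventually_gridFilter_pos, eventually_gridFilter_le one_pos] with x hx hx1
  rw [← f.clm_apply hS hx.le]
  exact (f.clm hS _).le_of_opNorm_le (hK _ ⟨hx.le, hx1⟩) _

/-! ### Expansions along a smooth curve -/

section Curve

variable {Y : Type*} [NormedAddCommGroup Y] [NormedSpace ℝ Y] {G : X → Y} {U : Set X} {δ : ℝ}
  {v : ℝ → X}

theorem isBigO_comp_sub_comp (hδ : 0 < δ) (hU : ∀ t ∈ Icc t₀ T, Metric.ball (v t) δ ⊆ U)
    (hG : ∀ x ∈ U, DifferentiableAt ℝ G x) {C : ℝ} (hC : ∀ x ∈ U, ‖fderiv ℝ G x‖ ≤ C)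
    {z₁ z₂ : ℝ × ℝ → X} (h₁ : Tendsto (fun x => z₁ x - v x.2) (gridFilter t₀ T) (𝓝 0))
    (h₂ : Tendsto (fun x => z₂ x - v x.2) (gridFilter t₀ T) (𝓝 0)) :
    (fun x => G (z₁ x) - G (z₂ x)) =O[gridFilter t₀ T] fun x => z₁ x - z₂ x := by
  refine IsBigO.of_bound C ?_
  filter_upwards [eventually_mem_ball hδ h₁, eventually_mem_ball hδ h₂,
    eventually_gridFilter_mem] with x hx₁ hx₂ hx
  exact (convex_ball _ _).norm_image_sub_le_of_norm_fderiv_le (fun y hy => hG y (hU _ hx.1 hy))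
    (fun y hy => hC y (hU _ hx.1 hy)) hx₂ hx₁

/-- Taylor expansion of a curve at the grid points. The curve has to be smooth slightly beyond `T`,
because the nodes `c` may exceed `1`. -/
theorem isBigO_curve_sub_taylor {f : ℝ → Y} {r : ℕ} {c : ℝ} (hc : 0 ≤ c) {ε : ℝ} (hε : 0 < ε)
    (hf : ∀ t ∈ Icc t₀ (T + ε), ContDiffAt ℝ r f t) :
    (fun x => f (x.2 + c * x.1) - ∑ k ∈ Finset.range r,
      ((c * x.1) ^ k / (k.factorial : ℝ)) • iteratedDeriv k f x.2)
      =O[gridFilter t₀ T] fun x => x.1 ^ r := by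
  obtain ⟨C, hC⟩ := exists_norm_sub_taylor_le hf
  refine IsBigO.of_bound (C * c ^ r) ?_
  have hε' : 0 < ε / (c + 1) := by positivity
  filter_upwards [eventually_gridFilter_pos, eventually_gridFilter_le hε',
    eventually_gridFilter_mem] with x hx hx1 hx2
  have h1 : c * x.1 ≤ ε := by
    rw [le_div_iff₀ (by positivity)] at hx1
    nlinarith
  have := hC x.2 ⟨hx2.1.1, by linarith [hx2.1.2]⟩ (c * x.1) (by positivity)
    (by linarith [hx2.1.2])
  rw [Real.norm_of_nonneg (pow_nonneg hx.le _)]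
  rwa [mul_pow, ← mul_assoc] at this

theorem isBigO_curve_sub {r : ℕ} (hr : 1 ≤ r) (hv : ContDiff ℝ r v) {c : ℝ} (hc : 0 ≤ c) :
    (fun x => v (x.2 + c * x.1) - v x.2) =O[gridFilter t₀ T] fun x => x.1 ^ 1 := by
  have := isBigO_curve_sub_taylor (t₀ := t₀) (T := T) (f := v) (r := 1) hc one_pos
    fun t _ => (hv.of_le (by exact_mod_cast hr)).contDiffAt
  simpa using this

/-- The open set where a smooth function composed with the curve is smooth contains a compact
interval larger than `[t₀, T]`. -/
theorem exists_contDiffAt_comp {r : ℕ} (hT : t₀ ≤ T) (hδ : 0 < δ)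
    (hUo : IsOpen U) (hU : ∀ t ∈ Icc t₀ T, Metric.ball (v t) δ ⊆ U)
    (hG : ContDiffOn ℝ r G U) (hv : ContDiff ℝ r v) :
    ∃ ε > 0, ∀ t ∈ Icc t₀ (T + ε), ContDiffAt ℝ r (G ∘ v) t := by
  have hJ : IsOpen (v ⁻¹' U) := hUo.preimage hv.continuous
  have hIJ : ∀ t ∈ Icc t₀ T, t ∈ v ⁻¹' U := fun t ht => hU t ht (Metric.mem_ball_self hδ)
  obtain ⟨ε, hε, hεJ⟩ := Metric.isOpen_iff.1 hJ T (hIJ T ⟨hT, le_rfl⟩)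
  refine ⟨ε / 2, half_pos hε, fun t ht => ?_⟩
  have htJ : t ∈ v ⁻¹' U := by
    rcases le_or_gt t T with h | h
    · exact hIJ t ⟨ht.1, h⟩
    · refine hεJ ?_
      rw [Metric.mem_ball, Real.dist_eq, abs_of_pos (sub_pos.2 h)]
      linarith [ht.2]
  exact (hG.contDiffAt (hUo.mem_nhds htJ)).comp t hv.contDiffAt

/-- A perturbation of size `O(h^r)` of a curve may be inserted into a `C^r` function without
changing the Taylor expansion of order `r`. -/
theorem isBigO_comp_sub_taylor {r : ℕ} (hr : 1 ≤ r) (hT : t₀ ≤ T) (hδ : 0 < δ)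
    (hUo : IsOpen U) (hU : ∀ t ∈ Icc t₀ T, Metric.ball (v t) δ ⊆ U)
    (hG : ContDiffOn ℝ r G U) (hv : ContDiff ℝ r v) {C : ℝ} (hC : ∀ x ∈ U, ‖fderiv ℝ G x‖ ≤ C)
    {c : ℝ} (hc : 0 ≤ c) {z : ℝ × ℝ → X}
    (hz : (fun x => z x - v (x.2 + c * x.1)) =O[gridFilter t₀ T] fun x => x.1 ^ r) :
    (fun x => G (z x) - ∑ k ∈ Finset.range r,
      ((c * x.1) ^ k / (k.factorial : ℝ)) • iteratedDeriv k (G ∘ v) x.2)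
      =O[gridFilter t₀ T] fun x => x.1 ^ r := by
  obtain ⟨ε, hε, hGv⟩ := exists_contDiffAt_comp hT hδ hUo hU hG hv
  have h1 := isBigO_curve_sub_taylor (t₀ := t₀) hc hε hGv
  have h2 := tendsto_zero_of_isBigO_pow le_rfl (isBigO_curve_sub (t₀ := t₀) (T := T) hr hv hc)
  have h3 : Tendsto (fun x => z x - v x.2) (gridFilter t₀ T) (𝓝 0) := by
    simpa using (tendsto_zero_of_isBigO_pow hr hz).add h2
  have h4 := (isBigO_comp_sub_comp hδ hU (fun x hx => (hG.contDiffAt (hUo.mem_nhds hx)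
    ).differentiableAt (by exact_mod_cast (Nat.one_le_iff_ne_zero.1 hr))) hC h3 h2).trans hz
  refine (h4.add h1).congr_left fun x => ?_
  simp only [Function.comp]
  abel

/-- Taylor expansion of `G (z + e)` in the direction `e`. -/
theorem isBigO_sub_taylor_iteratedFDeriv {n : ℕ} (hδ : 0 < δ)
    (hUo : IsOpen U) (hU : ∀ t ∈ Icc t₀ T, Metric.ball (v t) δ ⊆ U) (hG : ContDiffOn ℝ n G U)
    {C : ℝ} (hC : ∀ x ∈ U, ‖iteratedFDeriv ℝ n G x‖ ≤ C) {z e : ℝ × ℝ → X}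
    (hz : Tendsto (fun x => z x - v x.2) (gridFilter t₀ T) (𝓝 0))
    (he : Tendsto e (gridFilter t₀ T) (𝓝 0)) :
    (fun x => G (z x + e x) - ∑ m ∈ Finset.range n,
      (m.factorial : ℝ)⁻¹ • iteratedFDeriv ℝ m G (z x) fun _ => e x)
      =O[gridFilter t₀ T] fun x => ‖e x‖ ^ n := by
  have hze : Tendsto (fun x => (z x + e x) - v x.2) (gridFilter t₀ T) (𝓝 0) := by
    have := hz.add he
    rw [add_zero] at this
    exact this.congr fun x => by abel
  refine IsBigO.of_bound C ?_
  filter_upwards [eventually_mem_ball hδ hz, eventually_mem_ball hδ hze,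
    eventually_gridFilter_mem] with x hx₁ hx₂ hx
  have hseg : ∀ s ∈ Icc (0 : ℝ) 1, z x + s • e x ∈ U := fun s hs => by
    refine hU _ hx.1 ?_
    have := (convex_ball (v x.2) δ).add_smul_sub_mem hx₁ hx₂ hs
    simpa using this
  rw [norm_pow, norm_norm]
  exact norm_sub_taylor_iteratedFDeriv_le
    (fun s hs => hG.contDiffAt (hUo.mem_nhds (hseg s hs))) fun s hs => hC _ (hseg s hs)

end Curve

end

/-! ### Expansion of the nonlinearity at a stage -/

section

variable {X : Type*} [NormedAddCommGroup X] [NormedSpace ℝ X] {S : ℝ → X →L[ℝ] X} {t₀ T : ℝ}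

theorem isBigO_multilinear_apply {Y : Type*} [NormedAddCommGroup Y] [NormedSpace ℝ Y] {m a : ℕ}
    {f : ℝ × ℝ → X [×m]→L[ℝ] Y} {e : Fin m → ℝ × ℝ → X} {d : Fin m → ℕ}
    (hf : f =O[gridFilter t₀ T] fun x => x.1 ^ a)
    (he : ∀ r, e r =O[gridFilter t₀ T] fun x => x.1 ^ d r) :
    (fun x => f x fun r => e r x) =O[gridFilter t₀ T] fun x => x.1 ^ (a + ∑ r, d r) := by
  have h1 : (fun x => f x fun r => e r x) =O[gridFilter t₀ T] fun x => ‖f x‖ * ∏ r, ‖e r x‖ := by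
    refine IsBigO.of_bound 1 (Eventually.of_forall fun x => ?_)
    rw [one_mul, Real.norm_of_nonneg (by positivity)]
    exact ContinuousMultilinearMap.le_opNorm _ _
  refine h1.trans ((hf.norm_left.mul
    (IsBigO.finsetProd (s := Finset.univ) fun r _ => (he r).norm_left)).congr_right fun x => ?_)
  rw [pow_add, Finset.prod_pow_eq_pow_sum]

/-- The multilinear map `h^(l+1) / (l! m!) (d/dt)^l D^m N (v t)`, at `x = (h, t)`: the coefficient
of `c^l (e, …, e)` in the expansion of `h N (v (t + c h) + e)`. It is set to zero where
`l + m ≥ p`, since these terms are of higher order than the smoothness allows for. -/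
def nodeMap (N : X → X) (v : ℝ → X) (p : ℕ) (x : ℝ × ℝ) (l m : ℕ) : X [×m]→L[ℝ] X :=
  if l + m < p then
    (x.1 ^ (l + 1) / ((l.factorial : ℝ) * (m.factorial : ℝ))) •
      iteratedDeriv l (iteratedFDeriv ℝ m N ∘ v) x.2
  else 0

variable {N : X → X} {v : ℝ → X} {U : Set X} {δ : ℝ} {p q : ℕ}

theorem contDiffOn_iteratedFDeriv (hUo : IsOpen U) (hN : ContDiffOn ℝ p N U) {r m : ℕ}
    (h : r + m ≤ p) : ContDiffOn ℝ r (iteratedFDeriv ℝ m N) U := fun x hx =>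
  ((hN.contDiffAt (hUo.mem_nhds hx)).iteratedFDeriv_right (i := m) (m := r)
    (by exact_mod_cast h)).contDiffWithinAt

theorem isBigO_nodeMap (hT : t₀ ≤ T) (hδ : 0 < δ) (hUo : IsOpen U)
    (hU : ∀ t ∈ Icc t₀ T, Metric.ball (v t) δ ⊆ U) (hN : ContDiffOn ℝ p N U)
    (hv : ContDiff ℝ p v) (l m : ℕ) :
    (fun x => nodeMap N v p x l m) =O[gridFilter t₀ T] fun x => x.1 ^ (l + 1) := by
  unfold nodeMap
  split_ifs with hlm
  · obtain ⟨ε, hε, hc⟩ := exists_contDiffAt_comp hT hδ hUo hU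
      (contDiffOn_iteratedFDeriv hUo hN (r := l) hlm.le)
      (hv.of_le (by exact_mod_cast (by omega : l ≤ p)))
    have h1 := isBigO_one_of_continuousOn (t₀ := t₀) (T := T)
      (g := iteratedDeriv l (iteratedFDeriv ℝ m N ∘ v)) fun t ht =>
        (continuousAt_iteratedDeriv (hc t ⟨ht.1, by linarith [ht.2]⟩) le_rfl).continuousWithinAt
    have h2 : (fun x : ℝ × ℝ => x.1 ^ (l + 1) / ((l.factorial : ℝ) * (m.factorial : ℝ)))
        =O[gridFilter t₀ T] fun x => x.1 ^ (l + 1) := by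
      simp only [div_eq_inv_mul]
      exact (isBigO_refl _ _).const_mul_left _
    simpa using h2.smul h1
  · exact isBigO_zero _ _

/-- Expansion of `h (N (z + e) - N (v t))` for a perturbation `z` of `v (t + c h)` and a small
vector `e`, first in powers of `e` and then in powers of `h`. -/
theorem isBigO_sub_nodeMap (hT : t₀ ≤ T) (hδ : 0 < δ) (hUo : IsOpen U)
    (hU : ∀ t ∈ Icc t₀ T, Metric.ball (v t) δ ⊆ U) (hN : ContDiffOn ℝ (q + 1 : ℕ) N U)
    {C : ℝ} (hC : ∀ x ∈ U, ∀ m, 1 ≤ m → m ≤ q + 1 → ‖iteratedFDeriv ℝ m N x‖ ≤ C)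
    (hv : ContDiff ℝ (q + 1 : ℕ) v) {c : ℝ} (hc : 0 ≤ c) {z e : ℝ × ℝ → X}
    (hz : (fun x => z x - v (x.2 + c * x.1)) =O[gridFilter t₀ T] fun x => x.1 ^ (q + 1))
    (he : e =O[gridFilter t₀ T] fun x => x.1 ^ 1) :
    (fun x => x.1 • (N (z x + e x) - N (v x.2))
      - ∑ k ∈ Finset.range q, (c ^ (k + 1) / ((k + 1).factorial : ℝ)) •
          (x.1 ^ (k + 2) • iteratedDeriv (k + 1) (N ∘ v) x.2)
      - ∑ l ∈ Finset.range q, ∑ m ∈ Finset.range q,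
          c ^ l • nodeMap N v (q + 1) x l (m + 1) fun _ => e x)
      =O[gridFilter t₀ T] fun x => x.1 ^ (q + 2) := by
  have hfd : ∀ m ≤ q, ∀ x ∈ U, ‖fderiv ℝ (iteratedFDeriv ℝ m N) x‖ ≤ C := fun m hm x hx => by
    rw [norm_fderiv_iteratedFDeriv]
    exact hC x hx _ (by omega) (by omega)
  have hN1 : ∀ x ∈ U, ‖fderiv ℝ N x‖ ≤ C := fun x hx => by
    have := hC x hx 1 le_rfl (by omega)
    rwa [← norm_iteratedFDeriv_fderiv (n := 0), norm_iteratedFDeriv_zero] at this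
  have hzv : Tendsto (fun x => z x - v x.2) (gridFilter t₀ T) (𝓝 0) := by
    simpa using (tendsto_zero_of_isBigO_pow (by omega) hz).add
      (tendsto_zero_of_isBigO_pow le_rfl (isBigO_curve_sub (t₀ := t₀) (T := T)
        (by omega : 1 ≤ q + 1) hv hc))
  have hA : (fun x => N (z x + e x) - ∑ m ∈ Finset.range (q + 1),
      (m.factorial : ℝ)⁻¹ • iteratedFDeriv ℝ m N (z x) fun _ => e x)
      =O[gridFilter t₀ T] fun x => x.1 ^ (q + 1) := by
    refine (isBigO_sub_taylor_iteratedFDeriv hδ hUo hU hN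
      (fun x hx => hC x hx _ (by omega) le_rfl) hzv
      (tendsto_zero_of_isBigO_pow le_rfl he)).trans ?_
    simpa using he.norm_left.pow (q + 1)
  have hB := isBigO_comp_sub_taylor (by omega) hT hδ hUo hU hN hv hN1 hc hz
  have hD : ∀ m < q, (fun x => (iteratedFDeriv ℝ (m + 1) N (z x) fun _ => e x)
      - ∑ l ∈ Finset.range (q - m), ((c * x.1) ^ l / (l.factorial : ℝ)) •
        iteratedDeriv l (iteratedFDeriv ℝ (m + 1) N ∘ v) x.2 fun _ => e x)
      =O[gridFilter t₀ T] fun x => x.1 ^ (q + 1) := by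
    intro m hm
    have h1 := isBigO_comp_sub_taylor (r := q - m) (by omega) hT hδ hUo hU
      (contDiffOn_iteratedFDeriv hUo hN (m := m + 1) (r := q - m) (by omega))
      (hv.of_le (by exact_mod_cast (by omega : q - m ≤ q + 1))) (hfd (m + 1) (by omega)) hc
      (hz.trans (isBigO_pow_of_le (by omega)))
    refine ((isBigO_multilinear_apply h1 fun _ => he).congr_left fun x => ?_).congr_right fun x => ?_
    · simp
    · congr 1
      simp
      omega
  have hE : (fun x => ∑ m ∈ Finset.range q, ((m + 1).factorial : ℝ)⁻¹ •
      ((iteratedFDeriv ℝ (m + 1) N (z x) fun _ => e x)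
      - ∑ l ∈ Finset.range (q - m), ((c * x.1) ^ l / (l.factorial : ℝ)) •
        iteratedDeriv l (iteratedFDeriv ℝ (m + 1) N ∘ v) x.2 fun _ => e x))
      =O[gridFilter t₀ T] fun x => x.1 ^ (q + 1) :=
    IsBigO.fun_sum fun m hm => (hD m (Finset.mem_range.1 hm)).const_smul_left _
  have hsum := (hA.add hB).add hE
  have hh : (fun x : ℝ × ℝ => x.1) =O[gridFilter t₀ T] fun x => x.1 := isBigO_refl _ _
  refine ((hh.smul hsum).congr_left fun x => ?_).congr_right fun x => ?_
  · have h1 : ∑ l ∈ Finset.range q, ∑ m ∈ Finset.range q,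
        c ^ l • nodeMap N v (q + 1) x l (m + 1) (fun _ => e x) =
        x.1 • ∑ m ∈ Finset.range q, ((m + 1).factorial : ℝ)⁻¹ •
          ∑ l ∈ Finset.range (q - m), ((c * x.1) ^ l / (l.factorial : ℝ)) •
            iteratedDeriv l (iteratedFDeriv ℝ (m + 1) N ∘ v) x.2 fun _ => e x := by
      rw [Finset.sum_comm, Finset.smul_sum]
      refine Finset.sum_congr rfl fun m _ => ?_
      rw [Finset.smul_sum, Finset.smul_sum,
        ← Finset.sum_subset (Finset.range_mono (Nat.sub_le q m))]
      · refine Finset.sum_congr rfl fun l hl => ?_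
        rw [nodeMap, if_pos (by have := Finset.mem_range.1 hl; omega),
          smul_apply, smul_smul, smul_smul, smul_smul]
        congr 1
        rw [mul_pow]
        field_simp
        ring
      · intro l _ hl
        rw [nodeMap, if_neg (by rw [Finset.mem_range] at hl; omega)]
        simp
    have h2 : ∑ k ∈ Finset.range q, (c ^ (k + 1) / ((k + 1).factorial : ℝ)) •
          (x.1 ^ (k + 2) • iteratedDeriv (k + 1) (N ∘ v) x.2) =
        x.1 • ∑ k ∈ Finset.range q, ((c * x.1) ^ (k + 1) / ((k + 1).factorial : ℝ)) •
          iteratedDeriv (k + 1) (N ∘ v) x.2 := by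
      rw [Finset.smul_sum]
      refine Finset.sum_congr rfl fun k _ => ?_
      rw [smul_smul, smul_smul]
      congr 1
      ring
    rw [h1, h2, ← smul_sub, ← smul_sub]
    congr 1
    simp only [smul_sub, Finset.sum_sub_distrib]
    rw [Finset.sum_range_succ', Finset.sum_range_succ']
    simp
    abel
  · rw [smul_eq_mul]
    ring

end

/-! ### Expansion of the stages in trees -/

section

variable {X : Type*} [NormedAddCommGroup X] [NormedSpace ℝ X] {S : ℝ → X →L[ℝ] X} {t₀ T : ℝ}

theorem isBigO_multilinear_sub {m a p : ℕ} {f : ℝ × ℝ → X [×m + 1]→L[ℝ] X} {e e' : ℝ × ℝ → X}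
    (hf : f =O[gridFilter t₀ T] fun x => x.1 ^ a)
    (he : e =O[gridFilter t₀ T] fun x => x.1 ^ 0)
    (hee' : (fun x => e x - e' x) =O[gridFilter t₀ T] fun x => x.1 ^ p) :
    (fun x => f x (fun _ => e x) - f x fun _ => e' x)
      =O[gridFilter t₀ T] fun x => x.1 ^ (a + p) := by
  have he' : e' =O[gridFilter t₀ T] fun x => x.1 ^ 0 :=
    (he.sub (hee'.trans (isBigO_pow_of_le p.zero_le))).congr_left fun x => by abel
  have h1 : (fun x => f x (fun _ => e x) - f x fun _ => e' x) =O[gridFilter t₀ T]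
      fun x => ‖f x‖ * (‖e x‖ + ‖e' x‖) ^ m * ‖e x - e' x‖ := by
    refine IsBigO.of_bound (m + 1) (Eventually.of_forall fun x => ?_)
    rw [Real.norm_of_nonneg (by positivity)]
    have h2 := (f x).norm_image_sub_le (fun _ => e x) fun _ => e' x
    have h3 : (fun _ : Fin (m + 1) => e x) - (fun _ => e' x) = fun _ => e x - e' x := rfl
    rw [h3, pi_norm_const, pi_norm_const, pi_norm_const, Fintype.card_fin,
      Nat.add_sub_cancel] at h2
    have h4 : max ‖e x‖ ‖e' x‖ ≤ ‖e x‖ + ‖e' x‖ :=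
      max_le (by linarith [norm_nonneg (e' x)]) (by linarith [norm_nonneg (e x)])
    refine h2.trans ?_
    have h5 : max ‖e x‖ ‖e' x‖ ^ m ≤ (‖e x‖ + ‖e' x‖) ^ m :=
      pow_le_pow_left₀ (le_max_of_le_left (norm_nonneg _)) h4 m
    push_cast
    calc ‖f x‖ * (m + 1) * max ‖e x‖ ‖e' x‖ ^ m * ‖e x - e' x‖
        ≤ ‖f x‖ * (m + 1) * (‖e x‖ + ‖e' x‖) ^ m * ‖e x - e' x‖ := by gcongr
      _ = _ := by ring
  refine h1.trans (((hf.norm_left.mul ((he.norm_left.add he'.norm_left).pow m)).mul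
    hee'.norm_left).congr_right fun x => ?_)
  simp [pow_add]

namespace Method

variable [CompleteSpace X] {M : Method} {w : ℝ × ℝ → ℕ → X}
  {G : ℝ × ℝ → ℕ → (m : ℕ) → X [×m]→L[ℝ] X} {p q : ℕ}

theorem isBigO_psiStage (hS : IsC0Semigroup S) (k i : ℕ) {g : ℝ × ℝ → X} {b : ℝ × ℝ → ℝ}
    (hg : g =O[gridFilter t₀ T] b) :
    (fun x => M.psiStage S x.1 k i (g x)) =O[gridFilter t₀ T] b :=
  (IsBigO.fun_sum fun j _ => ((M.a i j).isBigO_apply hS hg).const_smul_left _).sub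
    ((isBigO_phi hS k (M.c i).coe_nonneg hg).const_smul_left _)

theorem isBigO_psiFinal (hS : IsC0Semigroup S) (k : ℕ) {g : ℝ × ℝ → X} {b : ℝ × ℝ → ℝ}
    (hg : g =O[gridFilter t₀ T] b) :
    (fun x => M.psiFinal S x.1 k (g x)) =O[gridFilter t₀ T] b := by
  refine (IsBigO.fun_sum fun i _ => ((M.b i).isBigO_apply hS hg).const_smul_left _).sub ?_
  simpa using isBigO_phi hS k zero_le_one hg

/-- If the vector of the leaf of order `k + 2` is `O(h^(k+2))`, and the multilinear maps with index
`l` are `O(h^(l+1))`, then the contribution of a tree is of the order of the tree. -/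
theorem isBigO_stageTerm (hS : IsC0Semigroup S)
    (hw : ∀ k, (fun x => w x k) =O[gridFilter t₀ T] fun x => x.1 ^ (k + 2))
    (hG : ∀ l m, (fun x => G x l m) =O[gridFilter t₀ T] fun x => x.1 ^ (l + 1))
    (τ : StiffTree) (i : ℕ) :
    (fun x => M.stageTerm S x.1 (w x) (G x) τ i) =O[gridFilter t₀ T] fun x => x.1 ^ τ.order := by
  induction τ generalizing i with
  | leaf k =>
    simp only [stageTerm, StiffTree.order]
    exact isBigO_psiStage hS _ _ (hw k)
  | node l m t ih =>
    simp only [stageTerm, StiffTree.order]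
    rw [add_comm 1 l]
    exact IsBigO.fun_sum fun j _ => (M.a i j).isBigO_apply hS
      ((isBigO_multilinear_apply (hG l (m + 1)) fun r => ih r j).const_smul_left _)

theorem isBigO_finalTerm (hS : IsC0Semigroup S)
    (hw : ∀ k, (fun x => w x k) =O[gridFilter t₀ T] fun x => x.1 ^ (k + 2))
    (hG : ∀ l m, (fun x => G x l m) =O[gridFilter t₀ T] fun x => x.1 ^ (l + 1))
    (τ : StiffTree) :
    (fun x => M.finalTerm S x.1 (w x) (G x) τ) =O[gridFilter t₀ T] fun x => x.1 ^ τ.order := by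
  cases τ with
  | leaf k =>
    simp only [finalTerm, StiffTree.order]
    exact isBigO_psiFinal hS _ (hw k)
  | node l m t =>
    simp only [finalTerm, StiffTree.order]
    rw [add_comm 1 l]
    exact IsBigO.fun_sum fun i _ => (M.b i).isBigO_apply hS
      ((isBigO_multilinear_apply (hG l (m + 1)) fun r =>
        isBigO_stageTerm hS hw hG (t r) i).const_smul_left _)

/-- Index type of the trees that are grafted together from a family of trees indexed by `ι`, with at
most `q` branches and weights `c ^ l`, `l < q`. -/
abbrev GraftIndex (q : ℕ) (ι : Type) : Type := Σ (_ : Fin q) (m : Fin q), Fin (m + 1) → ι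

/-- The trees `[l; τ (r 0), …, τ (r m)]`. -/
def graft {ι : Type} (τ : ι → StiffTree) (a : GraftIndex q ι) : StiffTree :=
  .node a.1 a.2.1 fun r => τ (a.2.2 r)

/-- Inserting sums over trees into the multilinear maps gives sums over grafted trees. Here `β`
stands for one row of the coefficients of the method. -/
theorem isBigO_nodes_sub (hS : IsC0Semigroup S)
    (hG : ∀ l m, (fun x => G x l m) =O[gridFilter t₀ T] fun x => x.1 ^ (l + 1))
    (s : Finset ℕ) (β : ℕ → PhiComb) {ι : Type} [Fintype ι] (τ : ι → StiffTree)
    {e : ℕ → ℝ × ℝ → X} (he : ∀ j ∈ s, e j =O[gridFilter t₀ T] fun x => x.1 ^ 0)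
    (heτ : ∀ j ∈ s, (fun x => e j x - ∑ a, M.stageTerm S x.1 (w x) (G x) (τ a) j)
      =O[gridFilter t₀ T] fun x => x.1 ^ p) :
    (fun x => ∑ j ∈ s, (β j).apply S x.1 (∑ l ∈ Finset.range q, ∑ m ∈ Finset.range q,
        (M.c j : ℝ) ^ l • G x l (m + 1) fun _ => e j x)
      - ∑ a : GraftIndex q ι, ∑ j ∈ s, (β j).apply S x.1 ((M.c j : ℝ) ^ (a.1 : ℕ) •
          G x a.1 (a.2.1 + 1) fun r => M.stageTerm S x.1 (w x) (G x) (τ (a.2.2 r)) j))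
      =O[gridFilter t₀ T] fun x => x.1 ^ (p + 1) := by
  have key : (fun x => ∑ j ∈ s, (β j).apply S x.1 (∑ l ∈ Finset.range q, ∑ m ∈ Finset.range q,
      (M.c j : ℝ) ^ l • (G x l (m + 1) (fun _ => e j x) -
        G x l (m + 1) fun _ => ∑ a, M.stageTerm S x.1 (w x) (G x) (τ a) j)))
      =O[gridFilter t₀ T] fun x => x.1 ^ (p + 1) := by
    refine IsBigO.fun_sum fun j hj => (β j).isBigO_apply hS (IsBigO.fun_sum fun l _ =>
      IsBigO.fun_sum fun m _ => IsBigO.const_smul_left ?_ _)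
    rw [add_comm p 1]
    exact isBigO_multilinear_sub ((hG l (m + 1)).trans (isBigO_pow_of_le (by omega)))
      (he j hj) (heτ j hj)
  refine key.congr' ?_ EventuallyEq.rfl
  filter_upwards [eventually_gridFilter_pos] with x hx
  rw [Finset.sum_comm (s := Finset.univ), ← Finset.sum_sub_distrib]
  refine Finset.sum_congr rfl fun j _ => ?_
  simp only [← PhiComb.clm_apply _ hS hx.le]
  rw [← map_sum, ← map_sub]
  congr 1
  simp only [smul_sub, Finset.sum_sub_distrib]
  congr 1
  rw [Fintype.sum_sigma, Finset.sum_range]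
  refine Finset.sum_congr rfl fun l _ => ?_
  rw [Fintype.sum_sigma, Finset.sum_range]
  refine Finset.sum_congr rfl fun m _ => ?_
  dsimp only
  rw [← Finset.smul_sum]
  congr 1
  exact (G x l (m + 1)).toMultilinearMap.map_sum
    fun (_ : Fin (m + 1)) a => M.stageTerm S x.1 (w x) (G x) (τ a) j

/-- Quantities `e i` that satisfy, up to `O(h^p)`, the recursion of the stage errors are sums over a
finite family of trees, up to `O(h^p)`. Stage by stage, the family is obtained from the leaves and
from grafting the trees of the earlier stages. -/
theorem exists_tree_expansion (hS : IsC0Semigroup S)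
    (hG : ∀ l m, (fun x => G x l m) =O[gridFilter t₀ T] fun x => x.1 ^ (l + 1))
    {e : ℕ → ℝ × ℝ → X} (he : ∀ i ∈ Finset.Icc 2 M.s, e i =O[gridFilter t₀ T] fun x => x.1 ^ 0)
    (hrec : ∀ i ∈ Finset.Icc 2 M.s, (fun x => e i x -
      (∑ k ∈ Finset.range q, M.psiStage S x.1 (k + 2) i (w x k) +
        ∑ j ∈ Finset.Ico 2 i, (M.a i j).apply S x.1 (∑ l ∈ Finset.range q, ∑ m ∈ Finset.range q,
          (M.c j : ℝ) ^ l • G x l (m + 1) fun _ => e j x)))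
      =O[gridFilter t₀ T] fun x => x.1 ^ p) :
    ∃ (ι : Type) (_ : Fintype ι) (τ : ι → StiffTree), ∀ i ∈ Finset.Icc 2 M.s,
      (fun x => e i x - ∑ a, M.stageTerm S x.1 (w x) (G x) (τ a) i)
        =O[gridFilter t₀ T] fun x => x.1 ^ p := by
  suffices H : ∀ n : ℕ, ∃ (ι : Type) (_ : Fintype ι) (τ : ι → StiffTree),
      ∀ i ∈ Finset.Icc 2 M.s, i ≤ n →
      (fun x => e i x - ∑ a, M.stageTerm S x.1 (w x) (G x) (τ a) i)
        =O[gridFilter t₀ T] fun x => x.1 ^ p by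
    obtain ⟨ι, hι, τ, h⟩ := H M.s
    exact ⟨ι, hι, τ, fun i hi => h i hi (Finset.mem_Icc.1 hi).2⟩
  intro n
  induction n with
  | zero =>
    refine ⟨Empty, inferInstance, fun a => a.elim, fun i hi hi0 => ?_⟩
    have := (Finset.mem_Icc.1 hi).1
    omega
  | succ n ih =>
    obtain ⟨ι, hι, τ, h⟩ := ih
    refine ⟨Fin q ⊕ GraftIndex q ι, inferInstance,
      Sum.elim (fun k => .leaf k) (graft τ), fun i hi hin => ?_⟩
    rw [Finset.mem_Icc] at hi
    have hj : ∀ j ∈ Finset.Ico 2 i, j ∈ Finset.Icc 2 M.s ∧ j ≤ n := fun j hj => by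
      rw [Finset.mem_Ico] at hj
      rw [Finset.mem_Icc]
      omega
    have h1 := isBigO_nodes_sub (M := M) (w := w) (q := q) hS hG (Finset.Ico 2 i) (M.a i) τ
      (fun j hj' => he j (hj j hj').1) fun j hj' => h j (hj j hj').1 (hj j hj').2
    have h2 := (hrec i (Finset.mem_Icc.2 hi)).add (h1.trans (isBigO_pow_of_le p.le_succ))
    refine h2.congr_left fun x => ?_
    rw [Fintype.sum_sum_type, Finset.sum_range]
    simp only [Sum.elim_inl, Sum.elim_inr, graft, stageTerm]
    abel

/-- Under the stiff order conditions, a quantity `r` that satisfies the recursion of the local error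
up to `O(h^(p+1))` is itself `O(h^(p+1))`. -/
theorem isBigO_of_stiffOrder (hS : IsC0Semigroup S)
    (hw : ∀ k, (fun x => w x k) =O[gridFilter t₀ T] fun x => x.1 ^ (k + 2))
    (hG : ∀ l m, (fun x => G x l m) =O[gridFilter t₀ T] fun x => x.1 ^ (l + 1))
    (hord : ∀ᶠ h in 𝓝[>] (0 : ℝ), M.StiffOrder S h p)
    {e : ℕ → ℝ × ℝ → X} (he : ∀ i ∈ Finset.Icc 2 M.s, e i =O[gridFilter t₀ T] fun x => x.1 ^ 0)
    (hrec : ∀ i ∈ Finset.Icc 2 M.s, (fun x => e i x -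
      (∑ k ∈ Finset.range q, M.psiStage S x.1 (k + 2) i (w x k) +
        ∑ j ∈ Finset.Ico 2 i, (M.a i j).apply S x.1 (∑ l ∈ Finset.range q, ∑ m ∈ Finset.range q,
          (M.c j : ℝ) ^ l • G x l (m + 1) fun _ => e j x)))
      =O[gridFilter t₀ T] fun x => x.1 ^ p)
    {r : ℝ × ℝ → X} (hr : (fun x => r x -
      (∑ k ∈ Finset.range q, M.psiFinal S x.1 (k + 2) (w x k) +
        ∑ i ∈ Finset.Icc 2 M.s, (M.b i).apply S x.1 (∑ l ∈ Finset.range q, ∑ m ∈ Finset.range q,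
          (M.c i : ℝ) ^ l • G x l (m + 1) fun _ => e i x)))
      =O[gridFilter t₀ T] fun x => x.1 ^ (p + 1)) :
    r =O[gridFilter t₀ T] fun x => x.1 ^ (p + 1) := by
  obtain ⟨ι, hι, τ, h⟩ := exists_tree_expansion hS hG he hrec
  have hterm : ∀ σ : StiffTree, (fun x => M.finalTerm S x.1 (w x) (G x) σ)
      =O[gridFilter t₀ T] fun x => x.1 ^ (p + 1) := by
    intro σ
    rcases le_or_gt σ.order p with hσ | hσ
    · refine (isBigO_zero _ _).congr' ?_ EventuallyEq.rfl
      filter_upwards [eventually_gridFilter_fst hord] with x hx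
      exact (hx (w x) (G x) σ hσ).symm
    · exact (isBigO_finalTerm hS hw hG σ).trans (isBigO_pow_of_le hσ)
  have h1 := isBigO_nodes_sub (M := M) (w := w) (q := q) hS hG (Finset.Icc 2 M.s) M.b τ he h
  have h2 : (fun x => ∑ a : Fin q ⊕ GraftIndex q ι, M.finalTerm S x.1 (w x) (G x)
      (Sum.elim (fun k : Fin q => StiffTree.leaf k) (graft τ) a))
      =O[gridFilter t₀ T] fun x => x.1 ^ (p + 1) := IsBigO.fun_sum fun a _ => hterm _
  refine ((hr.add h1).add h2).congr_left fun x => ?_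
  rw [Fintype.sum_sum_type, Finset.sum_range]
  simp only [Sum.elim_inl, Sum.elim_inr, graft, finalTerm]
  abel

end Method

end

/-! ### The predictor: the exact flow with Taylor-expanded nonlinearity -/

section

variable {X : Type*} [NormedAddCommGroup X] [NormedSpace ℝ X] {S : ℝ → X →L[ℝ] X} {t₀ T : ℝ}

/-- `v + τ φ_1(τ L) y₁ + ∑_{k < q} τ^(k+2) φ_{k+2}(τ L) (f k)`. If `y₁ = F(v)` and `f k` is the
derivative of order `k + 1` of the nonlinearity along the solution through `v`, this is the solution
at distance `τ` of the equation in which the nonlinearity is replaced by its Taylor polynomial of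
degree `q`. In contrast to the solution, it is defined for all `τ ≥ 0`. -/
def predictor (S : ℝ → X →L[ℝ] X) (y₁ : X) (f : ℕ → X) (q : ℕ) (τ : ℝ) (v : X) : X :=
  v + τ • phi S 1 τ y₁ + ∑ k ∈ Finset.range q, τ ^ (k + 2) • phi S (k + 2) τ (f k)

variable [CompleteSpace X] {q : ℕ}

/-- The relations `L y_k = y_{k+1} - f_k` between the derivatives of the solution and of the
nonlinearity along it, in integrated form. In this form they involve bounded operators only and can
be differentiated in `t`, so that the domain of `L` plays no role. -/
theorem apply_sub_eq_integral_of_hasDerivWithinAt (hS : IsC0Semigroup S) {a b : ℝ} (hab : a < b)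
    {y f : ℕ → ℝ → X}
    (hy : ∀ k ≤ q, ∀ t ∈ Icc a b, HasDerivWithinAt (y k) (y (k + 1) t) (Icc a b) t)
    (hf : ∀ k < q, ∀ t ∈ Icc a b, HasDerivWithinAt (f k) (f (k + 1) t) (Icc a b) t)
    (h0 : ∀ t ∈ Icc a b, ∀ s, 0 ≤ s →
      S s (y 0 t) - y 0 t = ∫ r in (0 : ℝ)..s, S r (y 1 t - f 0 t))
    {k : ℕ} (hk : k ≤ q) {t : ℝ} (ht : t ∈ Icc a b) {s : ℝ} (hs : 0 ≤ s) :
    S s (y k t) - y k t = ∫ r in (0 : ℝ)..s, S r (y (k + 1) t - f k t) := by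
  have hB : ∀ z : X, ∫ r in (0 : ℝ)..s, S r z = (s • phiCLM hS 1 s) z := fun z => by
    rw [integral_apply_eq_smul_phi, smul_apply, phiCLM_apply hS 1 hs]
  induction k generalizing t with
  | zero => exact h0 t ht s hs
  | succ k ih =>
    have h1 : HasDerivWithinAt (fun t => S s (y k t) - y k t)
        (S s (y (k + 1) t) - y (k + 1) t) (Icc a b) t :=
      ((S s).hasFDerivAt.comp_hasDerivWithinAt t (hy k (by omega) t ht)).sub
        (hy k (by omega) t ht)
    have h2 : HasDerivWithinAt (fun t => (s • phiCLM hS 1 s) (y (k + 1) t - f k t))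
        ((s • phiCLM hS 1 s) (y (k + 1 + 1) t - f (k + 1) t)) (Icc a b) t :=
      (s • phiCLM hS 1 s).hasFDerivAt.comp_hasDerivWithinAt t
        ((hy (k + 1) hk t ht).sub (hf k (by omega) t ht))
    have h3 := h1.congr (f₁ := fun t => (s • phiCLM hS 1 s) (y (k + 1) t - f k t))
      (fun r hr => by rw [← hB, ih (by omega) hr]) (by rw [← hB, ih (by omega) ht])
    rw [hB]
    exact (uniqueDiffOn_Icc hab t ht).eq_deriv _ h3 h2

/-- The predictor is a Taylor polynomial of the solution plus an explicit remainder. -/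
theorem predictor_eq (hS : IsC0Semigroup S) {y f : ℕ → X}
    (h : ∀ k ≤ q, ∀ s, 0 ≤ s → S s (y k) - y k = ∫ r in (0 : ℝ)..s, S r (y (k + 1) - f k))
    {τ : ℝ} (hτ : 0 ≤ τ) :
    predictor S (y 1) (fun k => f (k + 1)) q τ (y 0) =
      ∑ k ∈ Finset.range (q + 1), (τ ^ k / (k.factorial : ℝ)) • y k
        + τ ^ (q + 1) • phi S (q + 1) τ (y (q + 1)) := by
  induction q with
  | zero => simp [predictor]
  | succ q ih =>
    have h1 := ih fun k hk => h k (by omega)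
    have h2 : predictor S (y 1) (fun k => f (k + 1)) (q + 1) τ (y 0) =
        predictor S (y 1) (fun k => f (k + 1)) q τ (y 0)
          + τ ^ (q + 2) • phi S (q + 2) τ (f (q + 1)) := by
      rw [predictor, predictor, Finset.sum_range_succ, ← add_assoc]
    have h3 := phi_eq_add_smul_phi_succ hS (h (q + 1) le_rfl) (q + 1) hτ
    have h4 : phi S (q + 2) τ (y (q + 2)) =
        phi S (q + 2) τ (y (q + 2) - f (q + 1)) + phi S (q + 2) τ (f (q + 1)) := by
      rw [← phi_add hS _ hτ, sub_add_cancel]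
    rw [h2, h1, Finset.sum_range_succ _ (q + 1), h3, h4, smul_add, smul_add, smul_smul, smul_smul,
      ← pow_succ, div_eq_mul_inv]
    abel

/-- The predictor is accurate to order `q + 1`, also at those points `t + c h` that lie beyond the
interval of existence of the solution, where `v` is any smooth extension of it. -/
theorem isBigO_predictor_sub (hS : IsC0Semigroup S) {v : ℝ → X}
    (hv : ContDiff ℝ (q + 1 : ℕ) v) {f : ℕ → ℝ → X}
    (h : ∀ t ∈ Icc t₀ T, ∀ k ≤ q, ∀ s, 0 ≤ s → S s (iteratedDeriv k v t) - iteratedDeriv k v t =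
      ∫ r in (0 : ℝ)..s, S r (iteratedDeriv (k + 1) v t - f k t)) {c : ℝ} (hc : 0 ≤ c) :
    (fun x => predictor S (iteratedDeriv 1 v x.2) (fun k => f (k + 1) x.2) q (c * x.1) (v x.2)
      - v (x.2 + c * x.1)) =O[gridFilter t₀ T] fun x => x.1 ^ (q + 1) := by
  have h1 := isBigO_curve_sub_taylor (t₀ := t₀) (T := T) (f := v) hc one_pos
    fun t _ => hv.contDiffAt
  have h2 := isBigO_phi hS (q + 1) hc (isBigO_one_of_continuousOn (t₀ := t₀) (T := T)
    (hv.continuous_iteratedDeriv (q + 1) le_rfl).continuousOn)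
  have h3 : (fun x : ℝ × ℝ => (c * x.1) ^ (q + 1)) =O[gridFilter t₀ T] fun x => x.1 ^ (q + 1) := by
    simp only [mul_pow]
    exact (isBigO_refl _ _).const_mul_left _
  have h4 := h3.smul h2
  simp only [pow_zero, smul_eq_mul, mul_one] at h4
  refine (h4.sub h1).congr' ?_ EventuallyEq.rfl
  filter_upwards [eventually_gridFilter_pos, eventually_gridFilter_mem] with x hx hx2
  have := predictor_eq hS (h x.2 hx2.1) (mul_nonneg hc hx.le)
  rw [iteratedDeriv_zero] at this
  rw [this]
  abel

/-- After one step, the predictor agrees with the solution up to `O(h^(q+2))`, by the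
variation-of-constants formula. -/
theorem isBigO_predictor_sub_solution {L : X →ₗ.[ℝ] X} (hS : IsC0Semigroup S)
    (hL : IsGenerator S L) {N : X → X} {v : ℝ → X} (hv : Continuous v)
    (hsol : ∀ t ∈ Icc t₀ T, v t ∈ L.domain ∧ HasDerivAt v (rhs L N (v t)) t)
    (hf : ∀ t ∈ Icc t₀ T, ContDiffAt ℝ (q + 1 : ℕ) (N ∘ v) t) :
    (fun x => predictor S (rhs L N (v x.2)) (fun k => iteratedDeriv (k + 1) (N ∘ v) x.2) q x.1
      (v x.2) - v (x.2 + x.1)) =O[gridFilter t₀ T] fun x => x.1 ^ (q + 2) := by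
  obtain ⟨C, hC⟩ := exists_norm_sub_taylor_le hf
  obtain ⟨K, hK0, hK⟩ := hS.exists_norm_le 1
  refine IsBigO.of_bound (K * C) ?_
  filter_upwards [eventually_gridFilter_pos, eventually_gridFilter_le one_pos,
    eventually_gridFilter_mem] with x hx hx1 hx2
  obtain ⟨h, t⟩ := x
  dsimp only at hx hx1 hx2 ⊢
  have hmem : ∀ s ∈ Icc 0 h, t + s ∈ Icc t₀ T := fun s hs =>
    ⟨by linarith [hx2.1.1, hs.1], by linarith [hx2.2, hs.2]⟩
  have hcf : ContinuousOn (fun s => (N ∘ v) (t + s)) (Icc 0 h) := fun s hs =>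
    ((hf _ (hmem s hs)).continuousAt.comp
      (f := fun s => t + s) (Continuous.continuousAt (by fun_prop))).continuousWithinAt
  have hcS : ∀ {g : ℝ → X}, ContinuousOn g (Icc 0 h) →
      IntervalIntegrable (fun s => S (h - s) (g s)) MeasureTheory.volume 0 h := fun hg =>
    (hS.continuousOn_apply (by fun_prop) (fun s hs => sub_nonneg.2 hs.2)
      hg).intervalIntegrable_of_Icc hx.le
  have hvoc := hL.variation_of_constants hS (y := fun s => v (t + s))
    (g := fun s => (N ∘ v) (t + s)) hx.le (by fun_prop) hcf
    (fun s hs => (hsol _ (hmem s (Ioo_subset_Icc_self hs))).1)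
    (fun s hs => ((hsol _ (hmem s (Ioo_subset_Icc_self hs))).2.comp_const_add
      t s).hasDerivWithinAt)
  set P : ℝ → X := fun s => ∑ k ∈ Finset.range (q + 1),
    (s ^ k / (k.factorial : ℝ)) • iteratedDeriv k (N ∘ v) t with hP
  have hcP : ContinuousOn P (Icc 0 h) := by fun_prop
  -- the Taylor polynomial contributes the `φ`-functions of the predictor
  have hint : ∫ s in (0 : ℝ)..h, S (h - s) (P s) = h • phi S 1 h (N (v t)) +
      ∑ k ∈ Finset.range q, h ^ (k + 2) • phi S (k + 2) h (iteratedDeriv (k + 1) (N ∘ v) t) := by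
    simp only [hP, map_sum, map_smul]
    rw [intervalIntegral.integral_finsetSum]
    · simp only [integral_pow_smul_apply]
      rw [Finset.sum_range_succ', add_comm]
      simp
    · intro k _
      have := hcS (g := fun s : ℝ => (s ^ k / (k.factorial : ℝ)) • iteratedDeriv k (N ∘ v) t)
        (by fun_prop)
      simpa using this
  have hlin : S h (v t) = v t + h • phi S 1 h (opApply L (v t)) := by
    have h1 := hL.apply_sub_eq_integral hS (hsol t hx2.1).1 hx.le
    rw [integral_apply_eq_smul_phi] at h1
    rw [← h1]
    abel
  have hpred : predictor S (rhs L N (v t)) (fun k => iteratedDeriv (k + 1) (N ∘ v) t) q h (v t) =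
      S h (v t) + ∫ s in (0 : ℝ)..h, S (h - s) (P s) := by
    rw [hint, hlin, predictor, rhs, phi_add hS 1 hx.le, smul_add]
    abel
  have hdiff : predictor S (rhs L N (v t)) (fun k => iteratedDeriv (k + 1) (N ∘ v) t) q h (v t)
      - v (t + h) = -∫ s in (0 : ℝ)..h, S (h - s) ((N ∘ v) (t + s) - P s) := by
    simp only [map_sub]
    rw [intervalIntegral.integral_sub (hcS hcf) (hcS hcP), ← hvoc, hpred]
    simp only [add_zero]
    abel
  rw [hdiff, norm_neg, Real.norm_of_nonneg (pow_nonneg hx.le _)]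
  have hbound := intervalIntegral.norm_integral_le_of_norm_le_const (a := 0) (b := h)
    (f := fun s => S (h - s) ((N ∘ v) (t + s) - P s)) (C := K * (C * h ^ (q + 1))) ?_
  · refine hbound.trans_eq ?_
    rw [sub_zero, abs_of_pos hx]
    ring
  · intro s hs
    rw [uIoc_of_le hx.le] at hs
    have hs' : s ∈ Icc 0 h := Ioc_subset_Icc_self hs
    have h1 : ‖(N ∘ v) (t + s) - P s‖ ≤ C * s ^ (q + 1) :=
      hC t hx2.1 s hs'.1 (by linarith [hx2.2, hs.2])
    have hC0 : 0 ≤ C := by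
      have h2 := (norm_nonneg _).trans h1
      exact nonneg_of_mul_nonneg_left h2 (pow_pos hs.1 _)
    refine ((S (h - s)).le_of_opNorm_le (hK _ ⟨by linarith [hs.2], by linarith [hs.1]⟩) _).trans ?_
    refine mul_le_mul_of_nonneg_left (h1.trans ?_) hK0
    exact mul_le_mul_of_nonneg_left (pow_le_pow_left₀ hs.1.le hs.2 _) hC0

end

/-! ### The local error -/

section

variable {X : Type*} [NormedAddCommGroup X] [NormedSpace ℝ X] {S : ℝ → X →L[ℝ] X} {t₀ T : ℝ}

theorem Method.stage_eq (M : Method) (L : X →ₗ.[ℝ] X) (N : X → X) (h : ℝ) (v : X) (i : ℕ) :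
    M.stage L S N h v i = v
      + ((M.c i : ℝ) * h) • ratApply (scaleOp ((M.c i : ℝ) * h) L) (M.Rstage i) (rhs L N v)
      + h • ∑ j ∈ Finset.Ico 2 i, (M.a i j).apply S h (N (M.stage L S N h v j) - N v) := by
  rw [Method.stage,
    Finset.sum_coe_sort (Finset.Ico 2 i)
      fun j => (M.a i j).apply S h (N (M.stage L S N h v j) - N v)]

theorem sum_apply_sub_sub [CompleteSpace X] (hS : IsC0Semigroup S) {h : ℝ} (hh : 0 ≤ h)
    (s : Finset ℕ) (β : ℕ → PhiComb) (q : ℕ) (d n w : ℕ → X) (κ : ℕ → ℕ → ℝ) :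
    ∑ j ∈ s, (β j).apply S h (h • d j - ∑ k ∈ Finset.range q, κ k j • w k - n j) =
      h • ∑ j ∈ s, (β j).apply S h (d j)
        - ∑ k ∈ Finset.range q, ∑ j ∈ s, κ k j • (β j).apply S h (w k)
        - ∑ j ∈ s, (β j).apply S h (n j) := by
  simp only [← PhiComb.clm_apply _ hS hh, map_sub, map_sum, map_smul, Finset.sum_sub_distrib,
    Finset.smul_sum]
  rw [Finset.sum_comm]

/-- The local error estimate for a curve `v` that is smooth on the whole line and solves the equation
on `[t₀, T]`. -/
theorem isBigO_step_sub [CompleteSpace X] {L : X →ₗ.[ℝ] X} (hS : IsC0Semigroup S)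
    (hL : IsGenerator S L) {N : X → X} {v : ℝ → X} (hT : t₀ < T) {q : ℕ}
    (hv : ContDiff ℝ (q + 1 : ℕ) v)
    (hsol : ∀ t ∈ Icc t₀ T, v t ∈ L.domain ∧ HasDerivAt v (rhs L N (v t)) t)
    {U : Set X} {δ : ℝ} (hδ : 0 < δ) (hUo : IsOpen U)
    (hU : ∀ t ∈ Icc t₀ T, Metric.ball (v t) δ ⊆ U) (hN : ContDiffOn ℝ (q + 1 : ℕ) N U)
    {C : ℝ} (hC : ∀ x ∈ U, ∀ m, 1 ≤ m → m ≤ q + 1 → ‖iteratedFDeriv ℝ m N x‖ ≤ C)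
    {M : Method} (hord : ∀ᶠ h in 𝓝[>] (0 : ℝ), M.StiffOrder S h (q + 1))
    (hRstage : ∀ i ∈ Finset.Icc 2 M.s, (fun x =>
      ratApply (scaleOp ((M.c i : ℝ) * x.1) L) (M.Rstage i) (rhs L N (v x.2))
        - phi S 1 ((M.c i : ℝ) * x.1) (rhs L N (v x.2)))
      =O[gridFilter t₀ T] fun x => x.1 ^ q)
    (hRfinal : (fun x => ratApply (scaleOp x.1 L) M.Rfinal (rhs L N (v x.2))
        - phi S 1 x.1 (rhs L N (v x.2))) =O[gridFilter t₀ T] fun x => x.1 ^ (q + 1)) :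
    (fun x => M.step L S N x.1 (v x.2) - v (x.2 + x.1))
      =O[gridFilter t₀ T] fun x => x.1 ^ (q + 2) := by
  have hq : 1 ≤ q + 1 := by omega
  -- the derivatives of the solution and of the nonlinearity along it
  obtain ⟨ε, hε, hf⟩ := exists_contDiffAt_comp hT.le hδ hUo hU hN hv
  have hf' : ∀ t ∈ Icc t₀ T, ContDiffAt ℝ (q + 1 : ℕ) (N ∘ v) t := fun t ht =>
    hf t ⟨ht.1, by linarith [ht.2]⟩
  have hy1 : ∀ t ∈ Icc t₀ T, iteratedDeriv 1 v t = rhs L N (v t) := fun t ht => by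
    rw [iteratedDeriv_one]
    exact (hsol t ht).2.deriv
  have hrel : ∀ t ∈ Icc t₀ T, ∀ k ≤ q, ∀ s, 0 ≤ s →
      S s (iteratedDeriv k v t) - iteratedDeriv k v t =
        ∫ r in (0 : ℝ)..s, S r (iteratedDeriv (k + 1) v t - iteratedDeriv k (N ∘ v) t) := by
    intro t ht k hk s hs
    refine apply_sub_eq_integral_of_hasDerivWithinAt hS hT
      (y := fun k => iteratedDeriv k v) (f := fun k => iteratedDeriv k (N ∘ v)) (q := q)
      (fun k hk t _ => (hasDerivAt_iteratedDeriv hv.contDiffAt (by omega)).hasDerivWithinAt)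
      (fun k hk t ht => (hasDerivAt_iteratedDeriv (hf' t ht) (by omega)).hasDerivWithinAt)
      ?_ hk ht hs
    intro t ht s hs
    simp only [iteratedDeriv_zero, hy1 t ht, Function.comp, rhs, add_sub_cancel_right]
    exact hL.apply_sub_eq_integral hS (hsol t ht).1 hs
  have hF : (fun x => rhs L N (v x.2)) =O[gridFilter t₀ T] fun x => x.1 ^ 0 :=
    isBigO_one_of_continuousOn (g := fun t => rhs L N (v t))
      (((hv.continuous_iteratedDeriv 1 (by exact_mod_cast hq)).continuousOn).congr
        fun t ht => (hy1 t ht).symm)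
  -- the stages, their predictors and errors
  set Us : ℕ → ℝ × ℝ → X := fun i x => M.stage L S N x.1 (v x.2) i with hUs
  set z : ℕ → ℝ × ℝ → X := fun i x => predictor S (rhs L N (v x.2))
    (fun k => iteratedDeriv (k + 1) (N ∘ v) x.2) q ((M.c i : ℝ) * x.1) (v x.2) with hz
  set w : ℝ × ℝ → ℕ → X := fun x k => x.1 ^ (k + 2) • iteratedDeriv (k + 1) (N ∘ v) x.2 with hw
  have hx1 : (fun x : ℝ × ℝ => x.1) =O[gridFilter t₀ T] fun x => x.1 ^ 1 := by
    simpa using isBigO_refl _ _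
  have hzv : ∀ i, (fun x => z i x - v (x.2 + M.c i * x.1)) =O[gridFilter t₀ T]
      fun x => x.1 ^ (q + 1) := fun i => by
    refine (isBigO_predictor_sub hS hv hrel (M.c i).coe_nonneg).congr' ?_ EventuallyEq.rfl
    filter_upwards [eventually_gridFilter_mem] with x hx
    rw [hz, hy1 _ hx.1]
  have hzv1 : ∀ i, (fun x => z i x - v x.2) =O[gridFilter t₀ T] fun x => x.1 ^ 1 := fun i =>
    (((hzv i).trans (isBigO_pow_of_le hq)).add
      (isBigO_curve_sub hq hv (M.c i).coe_nonneg)).congr_left fun x => by abel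
  have hNdiff : ∀ x ∈ U, DifferentiableAt ℝ N x := fun x hx =>
    (hN.contDiffAt (hUo.mem_nhds hx)).differentiableAt (by exact_mod_cast q.succ_ne_zero)
  have hN1 : ∀ x ∈ U, ‖fderiv ℝ N x‖ ≤ C := fun x hx => by
    have := hC x hx 1 le_rfl hq
    rwa [← norm_iteratedFDeriv_fderiv (n := 0), norm_iteratedFDeriv_zero] at this
  have hUv : ∀ i ∈ Finset.Icc 2 M.s, (fun x => Us i x - v x.2) =O[gridFilter t₀ T]
      fun x => x.1 ^ 1 := by
    intro i
    induction i using Nat.strong_induction_on with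
    | _ i ih =>
      intro hi
      rw [Finset.mem_Icc] at hi
      have h1 := ((hRstage i (Finset.mem_Icc.2 hi)).trans (isBigO_pow_of_le q.zero_le)).add
        (isBigO_phi hS 1 (M.c i).coe_nonneg hF)
      have h2 : (fun x => ∑ j ∈ Finset.Ico 2 i, (M.a i j).apply S x.1 (N (Us j x) - N (v x.2)))
          =O[gridFilter t₀ T] fun x => x.1 ^ 0 := by
        refine IsBigO.fun_sum fun j hj => (M.a i j).isBigO_apply hS ?_
        rw [Finset.mem_Ico] at hj
        have h3 := ih j hj.2 (Finset.mem_Icc.2 ⟨hj.1, by omega⟩)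
        exact ((isBigO_comp_sub_comp hδ hU hNdiff hN1 (tendsto_zero_of_isBigO_pow le_rfl h3)
          (by simpa using tendsto_const_nhds)).trans h3).trans (isBigO_pow_of_le zero_le_one)
      have h4 := ((hx1.const_mul_left (M.c i : ℝ)).smul h1).add (hx1.smul h2)
      refine (h4.congr_left fun x => ?_).congr_right fun x => by simp
      simp only [hUs]
      rw [M.stage_eq L N x.1 (v x.2) i]
      simp only [sub_add_cancel]
      abel
  have he1 : ∀ i ∈ Finset.Icc 2 M.s, (fun x => Us i x - z i x) =O[gridFilter t₀ T]
      fun x => x.1 ^ 1 := fun i hi =>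
    ((hUv i hi).sub (hzv1 i)).congr_left fun x => by abel
  -- the expansion of the nonlinearity at the stages
  have hnode : ∀ i ∈ Finset.Icc 2 M.s, (fun x => x.1 • (N (Us i x) - N (v x.2))
      - ∑ k ∈ Finset.range q, ((M.c i : ℝ) ^ (k + 1) / ((k + 1).factorial : ℝ)) • w x k
      - ∑ l ∈ Finset.range q, ∑ m ∈ Finset.range q,
          (M.c i : ℝ) ^ l • nodeMap N v (q + 1) x l (m + 1) fun _ => Us i x - z i x)
      =O[gridFilter t₀ T] fun x => x.1 ^ (q + 2) := fun i hi => by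
    refine (isBigO_sub_nodeMap hT.le hδ hUo hU hN hC hv (M.c i).coe_nonneg (hzv i)
      (he1 i hi)).congr_left fun x => ?_
    rw [add_sub_cancel]
  -- cut off the vectors `w x k` at the order of differentiability; only `k < q` is used
  have hw' : ∀ k, (fun x => if k < q then w x k else 0) =O[gridFilter t₀ T]
      fun x => x.1 ^ (k + 2) := by
    intro k
    split_ifs with hk
    · have h1 := isBigO_one_of_continuousOn (t₀ := t₀) (T := T)
        (g := iteratedDeriv (k + 1) (N ∘ v)) fun t ht =>
          (continuousAt_iteratedDeriv (hf' t ht) (by omega)).continuousWithinAt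
      simpa using (isBigO_refl (fun x : ℝ × ℝ => x.1 ^ (k + 2)) (gridFilter t₀ T)).smul h1
    · exact isBigO_zero _ _
  have hww : ∀ (x : ℝ × ℝ) (Ψ : ℕ → X → X), ∑ k ∈ Finset.range q,
      Ψ k (if k < q then w x k else 0) = ∑ k ∈ Finset.range q, Ψ k (w x k) := fun x Ψ =>
    Finset.sum_congr rfl fun k hk => by rw [if_pos (Finset.mem_range.1 hk)]
  have hstep := Method.isBigO_of_stiffOrder (M := M) (w := fun x k => if k < q then w x k else 0)
    (G := nodeMap N v (q + 1)) (p := q + 1) (q := q) (e := fun i x => Us i x - z i x)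
    (r := fun x => M.step L S N x.1 (v x.2) - predictor S (rhs L N (v x.2))
      (fun k => iteratedDeriv (k + 1) (N ∘ v) x.2) q x.1 (v x.2)) hS hw'
    (fun l m => isBigO_nodeMap hT.le hδ hUo hU hN hv l m) hord
    (fun i hi => (he1 i hi).trans (isBigO_pow_of_le zero_le_one)) ?_ ?_
  · exact (hstep.add (isBigO_predictor_sub_solution hS hL hv.continuous hsol hf')).congr_left
      fun x => by abel
  · intro i hi
    have h1 : (fun x => ∑ j ∈ Finset.Ico 2 i, (M.a i j).apply S x.1 (x.1 • (N (Us j x) - N (v x.2))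
        - ∑ k ∈ Finset.range q, ((M.c j : ℝ) ^ (k + 1) / ((k + 1).factorial : ℝ)) • w x k
        - ∑ l ∈ Finset.range q, ∑ m ∈ Finset.range q,
          (M.c j : ℝ) ^ l • nodeMap N v (q + 1) x l (m + 1) fun _ => Us j x - z j x))
        =O[gridFilter t₀ T] fun x => x.1 ^ (q + 1) := by
      refine IsBigO.fun_sum fun j hj => (M.a i j).isBigO_apply hS
        ((hnode j ?_).trans (isBigO_pow_of_le (by omega)))
      rw [Finset.mem_Ico] at hj
      rw [Finset.mem_Icc] at hi ⊢
      omega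
    have h2 := ((hx1.const_mul_left (M.c i : ℝ)).smul (hRstage i hi)).congr_right
      (g₂ := fun x => x.1 ^ (q + 1)) fun x => by rw [smul_eq_mul]; ring
    refine (h2.add h1).congr' ?_ EventuallyEq.rfl
    filter_upwards [eventually_gridFilter_pos] with x hx
    rw [sum_apply_sub_sub hS hx.le, hww x fun k => M.psiStage S x.1 (k + 2) i]
    simp only [hUs, hz, hw, predictor, Method.psiStage]
    rw [M.stage_eq L N x.1 (v x.2) i]
    simp only [phi_smul, Finset.sum_sub_distrib, mul_pow, mul_smul, smul_sub,
      Nat.add_succ_sub_one]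
    abel
  · have h1 : (fun x => ∑ i ∈ Finset.Icc 2 M.s, (M.b i).apply S x.1
        (x.1 • (N (Us i x) - N (v x.2))
        - ∑ k ∈ Finset.range q, ((M.c i : ℝ) ^ (k + 1) / ((k + 1).factorial : ℝ)) • w x k
        - ∑ l ∈ Finset.range q, ∑ m ∈ Finset.range q,
          (M.c i : ℝ) ^ l • nodeMap N v (q + 1) x l (m + 1) fun _ => Us i x - z i x))
        =O[gridFilter t₀ T] fun x => x.1 ^ (q + 2) :=
      IsBigO.fun_sum fun i hi => (M.b i).isBigO_apply hS (hnode i hi)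
    have h2 := (hx1.smul hRfinal).congr_right
      (g₂ := fun x => x.1 ^ (q + 2)) fun x => by rw [smul_eq_mul]; ring
    refine (h2.add h1).congr' ?_ EventuallyEq.rfl
    filter_upwards [eventually_gridFilter_pos] with x hx
    rw [sum_apply_sub_sub hS hx.le, hww x fun k => M.psiFinal S x.1 (k + 2)]
    simp only [hUs, hw, predictor, Method.psiFinal, Method.step]
    simp only [phi_smul, Finset.sum_sub_distrib, smul_sub, Nat.add_succ_sub_one]
    abel

end

end IMEXP

end

theorem mainTheorem1 {X : Type*} [NormedAddCommGroup X] [NormedSpace ℝ X] [CompleteSpace X]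
    (L : X →ₗ.[ℝ] X) (S : ℝ → X →L[ℝ] X)
    (hS : IMEXP.IsC0Semigroup S) (hL : IMEXP.IsGenerator S L)
    (N : X → X) (u : ℝ → X) (t₀ T : ℝ) (hT : t₀ < T)
    (hu : IMEXP.IsSolution L N u t₀ T)
    (p : ℕ) (hp : 1 ≤ p) (hreg : IMEXP.IsRegular N u t₀ T p)
    (M : IMEXP.Method)
    (hdef : ∀ᶠ h in 𝓝[>] (0 : ℝ), M.OperatorsDefined L h)
    (hdom : ∀ᶠ h in 𝓝[>] (0 : ℝ), ∀ n : ℕ, t₀ + n * h + h ≤ T →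
      M.InOperatorDomains L h (IMEXP.rhs L N (u (t₀ + n * h))))
    (hord : ∀ᶠ h in 𝓝[>] (0 : ℝ), M.StiffOrder S h p)
    (hRstage : ∀ i ∈ Finset.Icc 2 M.s, IMEXP.IsUniformO t₀ T (p - 1) fun h t =>
      IMEXP.ratApply (IMEXP.scaleOp ((M.c i : ℝ) * h) L) (M.Rstage i) (IMEXP.rhs L N (u t))
        - IMEXP.phi S 1 ((M.c i : ℝ) * h) (IMEXP.rhs L N (u t)))
    (hRfinal : IMEXP.IsUniformO t₀ T p fun h t =>
      IMEXP.ratApply (IMEXP.scaleOp h L) M.Rfinal (IMEXP.rhs L N (u t))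
        - IMEXP.phi S 1 h (IMEXP.rhs L N (u t))) :
    IMEXP.IsUniformO t₀ T (p + 1) fun h t => M.step L S N h (u t) - u (t + h) := by
  obtain ⟨q, rfl⟩ : ∃ q, p = q + 1 := ⟨p - 1, by omega⟩
  obtain ⟨v, hv, hvu⟩ := IMEXP.exists_contDiff_eqOn_Icc hT (q + 1) hreg.solution
  obtain ⟨δ, hδ, hN, C, hC⟩ := hreg.nonlinearity
  have hmem : ∀ᶠ x in IMEXP.gridFilter t₀ T, v x.2 = u x.2 ∧ v (x.2 + x.1) = u (x.2 + x.1) := by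
    filter_upwards [IMEXP.eventually_gridFilter_mem, IMEXP.eventually_gridFilter_pos] with x hx hx0
    exact ⟨hvu hx.1, hvu ⟨by linarith [hx.1.1], hx.2⟩⟩
  -- the one-sided derivative of `u` is the derivative of the smooth extension
  have hsol : ∀ t ∈ Set.Icc t₀ T, v t ∈ L.domain ∧ HasDerivAt v (IMEXP.rhs L N (v t)) t := by
    intro t ht
    obtain ⟨hdomain, hderiv⟩ := hu t ht
    have h1 : HasDerivAt v (deriv v t) t :=
      (hv.differentiable (by exact_mod_cast q.succ_ne_zero) t).hasDerivAt
    have h2 := (uniqueDiffOn_Icc hT t ht).eq_deriv _ h1.hasDerivWithinAt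
      (hderiv.congr (fun s hs => hvu hs) (hvu ht))
    rw [hvu ht]
    exact ⟨hdomain, h2 ▸ h1⟩
  rw [IMEXP.isUniformO_iff_isBigO] at hRfinal ⊢
  refine (IMEXP.isBigO_step_sub (M := M) hS hL hT hv hsol hδ Metric.isOpen_thickening
    (fun t ht => ?_) hN hC hord (fun i hi => ?_) ?_).congr' ?_ EventuallyEq.rfl
  · rw [hvu ht]
    exact Metric.ball_subset_thickening (Set.mem_image_of_mem u ht) δ
  · refine (IMEXP.isUniformO_iff_isBigO.1 (hRstage i hi)).congr' ?_ EventuallyEq.rfl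
    filter_upwards [hmem] with x hx
    rw [hx.1]
  · refine hRfinal.congr' ?_ EventuallyEq.rfl
    filter_upwards [hmem] with x hx
    rw [hx.1]
  · filter_upwards [hmem] with x hx
    rw [hx.1, hx.2]
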